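/- Let $\alpha>1$, let $(\gamma_{\mathfrak u})$ be positive weights, one for each finite $\mathfrak u\subset\mathbb N=\{1,2,\dots\}$, with $\gamma_\emptyset=1$, let $b$ be a prime number and let $0\le w_1\le w_2\le\cdots$ be integers. Write $[s]=\{1,\dots,s\}$ and $\mathbb Z_*=\mathbb Z\setminus\{0\}$, and let $\zeta$ be the Riemann zeta function. For $s\in\mathbb N$ let $\mathcal H_s$ be the weighted Korobov space of continuous functions $f:[0,1]^s\to\mathbb C$, $1$-periodic in each variable, with finite norm $$\|f\|^2=\sum_{\mathfrak u\subseteq[s]}\gamma_{\mathfrak u}^{-1}\sum_{h_{\mathfrak u}\in\mathbb Z_*^{|\mathfrak u|}}\Big(\prod_{j\in\mathfrak u}|h_j|^\alpha\Big)\,|\widehat f((h_{\mathfrak u},0))|^2,\qquad \widehat f(h)=\int_{[0,1]^s}f(t)e^{-2\pi i h\cdot t}\,dt .$$ The worst-case error of points $x_0,\dots,x_{N-1}\in[0,1]^s$ (repetitions allowed) is $$\sup_{\|f\|\le1}\Big|\int_{[0,1]^s}f(x)\,dx-\tfrac1N\sum_{n=0}^{N-1}f(x_n)\Big| .$$ Let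 $e_{N,s}(z)$ be the worst-case error of the lattice points $\{kz/N\}$, $k=0,\dots,N-1$ (fractional parts taken componentwise), for $z\in\mathbb Z^s$. Let $e(N,s)$ be the infimum of the worst-case error over all choices of $N$ points, let $e(0,s)=\sup_{\|f\|\le1}|\int_{[0,1]^s} f(x)\,dx|$, and let $N_{\min}(\varepsilon,s)=\min\{N\in\mathbb N: e(N,s)\le\varepsilon\, e(0,s)\}$ for $\varepsilon\in(0,1)$. The integration problem is weakly tractable if $N_{\min}(\varepsilon,s)$ is always finite and $\log N_{\min}(\varepsilon,s)/(s+\varepsilon^{-1})\to0$ as $s+\varepsilon^{-1}\to\infty$. It is polynomially tractable if there are $c,p,q\ge0$ with $N_{\min}(\varepsilon,s)\le c\,s^q\varepsilon^{-p}$ for all $s\in\mathbb N$ and $\varepsilon\in(0,1)$, and strongly polynomially tractable if this holds with $q=0$. The $\varepsilon$-exponent of polynomial (respectively strong polynomial) tractability is the infimum of the $p\ge0$ for which this bound holds with some $c,q\ge0$ (respectively with some $c\ge0$ and $q=0$); the $s$-exponent is the infimum of the $q\ge0$ for which it holds with some $c,p\ge0$. Let $m,s\in\mathbb N$ and $N=b^m$.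 Put $\mathcal Z_{N,w}=\{z\in\{1,\dots,b^{m-w}-1\}:\gcd(z,N)=1\}$ if $w<m$ and $\mathcal Z_{N,w}=\{1\}$ if $w\ge m$. The reduced component-by-component algorithm constructs $z=(b^{w_1}z_1,\dots,b^{w_s}z_s)$ as follows: $z_1=1$, and for $d=1,\dots,s-1$ the number $z_{d+1}\in\mathcal Z_{N,w_{d+1}}$ is chosen to minimize $e_{N,d+1}^2((b^{w_1}z_1,\dots,b^{w_{d+1}}z_{d+1}))$ with $z_1,\dots,z_d$ kept fixed. For $\delta\in(0,\frac{\alpha-1}2]$, $s\in\mathbb N$ and $q\ge0$ define $$S_{\delta}(s)=\sum_{\emptyset\ne\mathfrak u\subseteq[s]}\gamma_{\mathfrak u}^{\frac1{\alpha-2\delta}}\Big(2\zeta\big(\tfrac{\alpha}{\alpha-2\delta}\big)\Big)^{|\mathfrak u|}b^{\max_{j\in\mathfrak u}w_j},\qquad C_{\delta,q}=\sup_{s\in\mathbb N}\frac{S_\delta(s)}{s^q}\in[0,\infty].$$ 1. For all $m,s\in\mathbb N$, every $z$ constructed by the algorithm with $N=b^m$, and all $\delta\in(0,\frac{\alpha-1}2]$,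 $$e_{N,s}(z)\le\big(2S_\delta(s)\big)^{\alpha/2-\delta}N^{-\alpha/2+\delta}.$$ 2. (a) If $C_{\delta,q}<\infty$ for some $\delta\in(0,\frac{\alpha-1}2]$ and $q\ge0$, then for all $m,s\in\mathbb N$ and every $z$ constructed by the algorithm with $N=b^m$, $$e_{N,s}(z)\le(2s^qC_{\delta,q})^{\alpha/2-\delta}N^{-\alpha/2+\delta},$$ and the problem is polynomially tractable with $\varepsilon$-exponent at most $\frac2{\alpha-2\delta}$ and $s$-exponent at most $q$; indeed $N_{\min}(\varepsilon,s)\le c\,s^q\varepsilon^{-2/(\alpha-2\delta)}$ for some $c\ge0$ and all $s\in\mathbb N$, $\varepsilon\in(0,1)$. (b) If $C_{\delta,0}<\infty$ for some $\delta\in(0,\frac{\alpha-1}2]$, then for all $m,s\in\mathbb N$ and every $z$ constructed by the algorithm with $N=b^m$, $$e_{N,s}(z)\le(2C_{\delta,0})^{\alpha/2-\delta}N^{-\alpha/2+\delta},$$ and the problem is strongly polynomially tractable with $\varepsilon$-exponent at most $\frac2{\alpha-2\delta}$. (c) If $$\lim_{s\to\infty}\frac1s\log\Big(\sum_{\emptyset\ne\mathfrak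 u\subseteq[s]}\gamma_{\mathfrak u}\,(2\zeta(\alpha))^{|\mathfrak u|}\,b^{\max_{j\in\mathfrak u}w_j}\Big)=0,$$ then the problem is weakly tractable. -/

import Mathlib

open scoped ENNReal
open MeasureTheory Filter Topology

namespace ReducedCBC

noncomputable section

/-! Coordinates are numbered `0, 1, 2, …` (instead of `1, 2, 3, …`), so `[s]` is `Finset.range s`.
The weights are `γ : Finset ℕ → ℝ`, one for each finite set of coordinates, and `w : ℕ → ℕ`
is the sequence of reduction exponents. -/

/-! ### The weighted Korobov space and worst-case errors -/

/-- The class of a point of `ℝ^s` modulo `1` in each coordinate. -/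
def toTorus {s : ℕ} (x : Fin s → ℝ) : UnitAddTorus (Fin s) :=
  fun j => (x j : UnitAddCircle)

/-- The set of coordinates in which the frequency `h` does not vanish. -/
def freqSupport {s : ℕ} (h : Fin s → ℤ) : Finset ℕ :=
  (Finset.univ.filter fun j => h j ≠ 0).map Fin.valEmbedding

/-- The squared norm of the weighted Korobov space,
`∑_u γ_u⁻¹ ∑_{h_u ∈ ℤ_*^u} ∏_{j ∈ u} |h_j|^α |f̂(h_u, 0)|²`, written as one sum over `h ∈ ℤ^s`
(`u` is the set of coordinates where `h` is nonzero); it is `∞` outside of the space. -/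
def korobovNormSq (α : ℝ) (γ : Finset ℕ → ℝ) {s : ℕ} (f : C(UnitAddTorus (Fin s), ℂ)) : ℝ≥0∞ :=
  ∑' h : Fin s → ℤ,
    ENNReal.ofReal ((γ (freqSupport h))⁻¹ *
        ∏ j ∈ Finset.univ.filter (fun j => h j ≠ 0), |(h j : ℝ)| ^ α) *
      ‖UnitAddTorus.mFourierCoeff f h‖ₑ ^ 2

/-- The unit ball of the weighted Korobov space. As `α > 1`, a function of finite norm has an
absolutely convergent Fourier series, so the members of the reproducing kernel Hilbert space are
exactly the continuous functions, `1`-periodic in each variable, of finite norm. -/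
def korobovBall (α : ℝ) (γ : Finset ℕ → ℝ) (s : ℕ) : Set C(UnitAddTorus (Fin s), ℂ) :=
  {f | korobovNormSq α γ f ≤ 1}

/-- The worst-case error of the QMC rule with the `N` points `x 0, …, x (N - 1)`. -/
def worstCaseError (α : ℝ) (γ : Finset ℕ → ℝ) {s N : ℕ} (x : Fin N → Fin s → ℝ) : ℝ≥0∞ :=
  ⨆ f ∈ korobovBall α γ s,
    ‖(∫ t in Set.Icc (0 : Fin s → ℝ) 1, f (toTorus t)) -
      (1 / (N : ℂ)) * ∑ n : Fin N, f (toTorus (x n))‖ₑ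

/-- The initial error `e(0,s)`. -/
def initialError (α : ℝ) (γ : Finset ℕ → ℝ) (s : ℕ) : ℝ≥0∞ :=
  ⨆ f ∈ korobovBall α γ s, ‖∫ t in Set.Icc (0 : Fin s → ℝ) 1, f (toTorus t)‖ₑ

/-- The `N`th minimal QMC worst-case error `e(N,s)`. -/
def minimalError (α : ℝ) (γ : Finset ℕ → ℝ) (N s : ℕ) : ℝ≥0∞ :=
  ⨅ x : Fin N → Set.Icc (0 : Fin s → ℝ) 1, worstCaseError α γ (fun n => (x n : Fin s → ℝ))

/-! ### Tractability -/

/-- The QMC information complexity `N_min(ε,s)`, with value `∞` if no `N` is large enough. -/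
def infoComplexity (α : ℝ) (γ : Finset ℕ → ℝ) (ε : ℝ) (s : ℕ) : ℕ∞ :=
  ⨅ N ∈ {N : ℕ | 1 ≤ N ∧ minimalError α γ N s ≤ ENNReal.ofReal ε * initialError α γ s}, (N : ℕ∞)

/-- Weak QMC tractability: `N_min(ε,s)` is finite and
`log N_min(ε,s) / (s + ε⁻¹) → 0` as `s + ε⁻¹ → ∞` (`s ≥ 1`, `0 < ε < 1`). -/
def WeaklyTractable (α : ℝ) (γ : Finset ℕ → ℝ) : Prop :=
  (∀ s : ℕ, 1 ≤ s → ∀ ε ∈ Set.Ioo (0 : ℝ) 1, infoComplexity α γ ε s ≠ ⊤) ∧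
  Tendsto
    (fun p : ℕ × ℝ => Real.log ((infoComplexity α γ p.2 p.1).toNat : ℝ) / ((p.1 : ℝ) + p.2⁻¹))
    (comap (fun p : ℕ × ℝ => (p.1 : ℝ) + p.2⁻¹) atTop ⊓
      𝓟 {p : ℕ × ℝ | 1 ≤ p.1 ∧ p.2 ∈ Set.Ioo (0 : ℝ) 1})
    (𝓝 0)

/-- `N_min(ε,s) ≤ c s^q ε^{-p}` for all `s ≥ 1` and `0 < ε < 1`, with some `c ≥ 0`. -/
def HasExponents (α : ℝ) (γ : Finset ℕ → ℝ) (p q : ℝ) : Prop :=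
  ∃ c : ℝ, 0 ≤ c ∧ ∀ s : ℕ, 1 ≤ s → ∀ ε ∈ Set.Ioo (0 : ℝ) 1,
    (infoComplexity α γ ε s : ℝ≥0∞) ≤ ENNReal.ofReal (c * (s : ℝ) ^ q * ε ^ (-p))

/-- Polynomial QMC tractability. -/
def PolynomiallyTractable (α : ℝ) (γ : Finset ℕ → ℝ) : Prop :=
  ∃ p q : ℝ, 0 ≤ p ∧ 0 ≤ q ∧ HasExponents α γ p q

/-- Strong polynomial QMC tractability. -/
def StronglyPolynomiallyTractable (α : ℝ) (γ : Finset ℕ → ℝ) : Prop :=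
  ∃ p : ℝ, 0 ≤ p ∧ HasExponents α γ p 0

/-- The `ε`-exponent of polynomial tractability. -/
def epsExponent (α : ℝ) (γ : Finset ℕ → ℝ) : ℝ :=
  sInf {p : ℝ | 0 ≤ p ∧ ∃ q : ℝ, 0 ≤ q ∧ HasExponents α γ p q}

/-- The `s`-exponent of polynomial tractability. -/
def dimExponent (α : ℝ) (γ : Finset ℕ → ℝ) : ℝ :=
  sInf {q : ℝ | 0 ≤ q ∧ ∃ p : ℝ, 0 ≤ p ∧ HasExponents α γ p q}

/-- The `ε`-exponent of strong polynomial tractability. -/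
def strongEpsExponent (α : ℝ) (γ : Finset ℕ → ℝ) : ℝ :=
  sInf {p : ℝ | 0 ≤ p ∧ HasExponents α γ p 0}

/-! ### Lattice rules and the reduced component-by-component construction -/

/-- The `N` points `{k z / N}`, `k = 0, …, N - 1`, generated by `z`. -/
def latticePoints (N : ℕ) {s : ℕ} (z : Fin s → ℤ) : Fin N → Fin s → ℝ :=
  fun k j => Int.fract (((k : ℕ) : ℝ) * (z j : ℝ) / (N : ℝ))

/-- The worst-case error `e_{N,s}(z)` of the lattice rule generated by `z`. -/
def latticeError (α : ℝ) (γ : Finset ℕ → ℝ) (N : ℕ) {s : ℕ} (z : Fin s → ℤ) : ℝ≥0∞ :=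
  worstCaseError α γ (latticePoints N z)

/-- The reduced search space for one component, with `N = b ^ m` and reduction exponent `v`. -/
def searchSet (b m v : ℕ) : Finset ℕ :=
  if v < m then (Finset.Icc 1 (b ^ (m - v) - 1)).filter fun z => Nat.gcd z (b ^ m) = 1 else {1}

/-- The generating vector `(b^{w_1} z_1, …, b^{w_d} z_d)`. -/
def genVector (b : ℕ) (w : ℕ → ℕ) (z : ℕ → ℕ) (d : ℕ) : Fin d → ℤ :=
  fun j => ((b ^ w j * z j : ℕ) : ℤ)

/-- The numbers `z 0, …, z (s - 1)` are a possible output of the reduced component-by-component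
algorithm with `N = b ^ m`: the first one is `1`, and each further one is chosen in its search
space so as to minimize the squared worst-case error, the earlier ones being kept. -/
def IsReducedCBC (α : ℝ) (γ : Finset ℕ → ℝ) (b m : ℕ) (w : ℕ → ℕ) (s : ℕ) (z : ℕ → ℕ) : Prop :=
  z 0 = 1 ∧ ∀ d : ℕ, 1 ≤ d → d < s →
    z d ∈ searchSet b m (w d) ∧
    ∀ y ∈ searchSet b m (w d),
      latticeError α γ (b ^ m) (genVector b w z (d + 1)) ^ 2 ≤
        latticeError α γ (b ^ m) (genVector b w (Function.update z d y) (d + 1)) ^ 2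

/-- `zgen ∈ ℤ^s` is a generating vector constructed by the reduced algorithm. -/
def IsReducedCBCVector (α : ℝ) (γ : Finset ℕ → ℝ) (b m : ℕ) (w : ℕ → ℕ) (s : ℕ)
    (zgen : Fin s → ℤ) : Prop :=
  ∃ z : ℕ → ℕ, IsReducedCBC α γ b m w s z ∧ zgen = genVector b w z s

/-! ### The constants -/

/-- The Riemann zeta function at a real argument `x > 1`. -/
def zetaReal (x : ℝ) : ℝ := (riemannZeta (x : ℂ)).re

/-- `∑_{∅ ≠ u ⊆ [s]} γ_u^{1/τ} (2 ζ(α/τ))^{|u|} b^{max_{j ∈ u} w_j}`. -/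
def weightSum (α : ℝ) (γ : Finset ℕ → ℝ) (b : ℕ) (w : ℕ → ℕ) (τ : ℝ) (s : ℕ) : ℝ :=
  ∑ u ∈ (Finset.range s).powerset.filter (fun u => u.Nonempty),
    γ u ^ (1 / τ) * (2 * zetaReal (α / τ)) ^ u.card * (b : ℝ) ^ u.sup w

/-- The constant `c_{s,α,γ,δ,w}`. -/
def errorConst (α : ℝ) (γ : Finset ℕ → ℝ) (b : ℕ) (w : ℕ → ℕ) (δ : ℝ) (s : ℕ) : ℝ :=
  (2 * weightSum α γ b w (α - 2 * δ) s) ^ (α / 2 - δ)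

/-- The supremum `C_{δ,q}`, possibly `∞`. -/
def supConst (α : ℝ) (γ : Finset ℕ → ℝ) (b : ℕ) (w : ℕ → ℕ) (δ q : ℝ) : ℝ≥0∞ :=
  ⨆ (s : ℕ) (_ : 1 ≤ s),
    ENNReal.ofReal (1 / (s : ℝ) ^ q * weightSum α γ b w (α - 2 * δ) s)

end

end ReducedCBC

/-! On the Fourier side the squared error of a lattice rule is the sum of the kernel coefficients
`freqWeight` over the nonzero dual lattice (`latticeError_sq`): Cauchy–Schwarz gives one inequality,
normalized truncations of the representer of the error give the other. Appending a component adds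
exactly the dual frequencies with nonzero last entry (`latticeError_succ_sq`), so the greedy choice
minimizes `errorIncrement`.

Put p = 1/τ with τ = α - 2δ, so that p ≤ 1 < αp. By subadditivity of x ↦ x^p (Jensen), the p-th
power of the increment is at most the same sum with the p-th powers of the weights. That sum is
averaged over the search space. With the first d frequencies fixed, the total over all y is at most
2ζ(αp) (`sum_searchSet_le`): the solutions y of the congruence number at most a gcd g, while only
multiples k of g occur. The search space has at least N/(2b^{w_d}) elements, so N(e_d²)^p grows at
step d by at most twice the growth of the weight sum. Monotonicity of w is what makes the two match
(`weightSumENN_succ`). Induction on d yields `IsReducedCBC.latticeError_rpow_le`.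

For tractability, N is taken as a power of b just above 2Sε^{-2/τ}, where S is the weight sum; this
costs at most a factor b (`infoComplexity_le`).

Sums over frequencies live in `ℝ≥0∞`, so rearranging them needs no convergence argument. -/

namespace ReducedCBC

noncomputable section

/-! ### Kernel coefficients and the Korobov norm. -/

/-- The factor `|k|^{-x}` for a nonzero frequency, and `1` for the frequency `0`. -/
def decay (x : ℝ) (k : ℤ) : ℝ≥0∞ :=
  if k = 0 then 1 else ENNReal.ofReal (|(k : ℝ)| ^ (-x))

/-- The Fourier coefficients of the reproducing kernel of the weighted Korobov space. -/
def freqWeight (α : ℝ) (γ : Finset ℕ → ℝ) {s : ℕ} (h : Fin s → ℤ) : ℝ≥0∞ :=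
  ENNReal.ofReal (γ (freqSupport h)) * ∏ j, decay α (h j)

/-- The nonzero frequencies in the dual lattice of the lattice rule generated by `z`. -/
def dualLattice (N : ℕ) {s : ℕ} (z : Fin s → ℤ) : Set (Fin s → ℤ) :=
  {h | h ≠ 0 ∧ (N : ℤ) ∣ ∑ j, h j * z j}

lemma decay_pos (x : ℝ) (k : ℤ) : decay x k ≠ 0 := by
  unfold decay
  split_ifs with h
  · simp
  · have : (0 : ℝ) < |(k : ℝ)| := by positivity
    simpa using Real.rpow_pos_of_pos this _

lemma decay_ne_top (x : ℝ) (k : ℤ) : decay x k ≠ ⊤ := by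
  unfold decay
  split_ifs <;> simp

lemma freqWeight_ne_zero {α : ℝ} {γ : Finset ℕ → ℝ} (hγ : ∀ u, 0 < γ u) {s : ℕ}
    (h : Fin s → ℤ) : freqWeight α γ h ≠ 0 := by
  refine mul_ne_zero (by simpa using hγ _) (Finset.prod_ne_zero_iff.2 fun _ _ => decay_pos _ _)

lemma freqWeight_ne_top {α : ℝ} {γ : Finset ℕ → ℝ} {s : ℕ}
    (h : Fin s → ℤ) : freqWeight α γ h ≠ ⊤ :=
  ENNReal.mul_ne_top ENNReal.ofReal_ne_top (ENNReal.prod_ne_top fun _ _ => decay_ne_top _ _)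

lemma decay_inv (x : ℝ) (k : ℤ) :
    (decay x k)⁻¹ = if k = 0 then 1 else ENNReal.ofReal (|(k : ℝ)| ^ x) := by
  unfold decay
  split_ifs with h
  · simp
  · have : (0 : ℝ) < |(k : ℝ)| := by positivity
    rw [← ENNReal.ofReal_inv_of_pos (Real.rpow_pos_of_pos this _), Real.rpow_neg this.le, inv_inv]

lemma ofReal_norm_weight {α : ℝ} {γ : Finset ℕ → ℝ} (hγ : ∀ u, 0 < γ u) {s : ℕ}
    (h : Fin s → ℤ) :
    ENNReal.ofReal ((γ (freqSupport h))⁻¹ *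
        ∏ j ∈ Finset.univ.filter (fun j => h j ≠ 0), |(h j : ℝ)| ^ α) = (freqWeight α γ h)⁻¹ := by
  unfold freqWeight
  rw [ENNReal.ofReal_mul (inv_nonneg.2 (hγ _).le), ENNReal.ofReal_inv_of_pos (hγ _),
    ENNReal.mul_inv (Or.inl (by simpa using hγ _)) (Or.inl ENNReal.ofReal_ne_top)]
  congr 1
  rw [ENNReal.prod_inv_distrib (fun _ _ _ _ _ => Or.inl (decay_pos _ _)),
    ENNReal.ofReal_prod_of_nonneg (fun i _ => by positivity), Finset.prod_filter]
  refine Finset.prod_congr rfl fun j _ => ?_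
  rw [decay_inv]
  by_cases hj : h j = 0 <;> simp [hj]

lemma korobovNormSq_eq {α : ℝ} {γ : Finset ℕ → ℝ} (hγ : ∀ u, 0 < γ u) {s : ℕ}
    (f : C(UnitAddTorus (Fin s), ℂ)) :
    korobovNormSq α γ f =
      ∑' h : Fin s → ℤ, (freqWeight α γ h)⁻¹ * ‖UnitAddTorus.mFourierCoeff f h‖ₑ ^ 2 :=
  tsum_congr fun h => by rw [ofReal_norm_weight hγ]

/-! ### The squared lattice error as a sum over the dual lattice. -/

lemma integral_toTorus {s : ℕ} (f : C(UnitAddTorus (Fin s), ℂ)) :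
    ∫ t in Set.Icc (0 : Fin s → ℝ) 1, f (toTorus t) = UnitAddTorus.mFourierCoeff f 0 := by
  rw [UnitAddTorus.mFourierCoeff_eq_integral (f : UnitAddTorus (Fin s) → ℂ) 0 0]
  have h1 : {x : Fin s → ℝ | ∀ i, x i ∈ Set.Ioc ((0 : Fin s → ℝ) i) ((0 : Fin s → ℝ) i + 1)} =
      Set.pi Set.univ fun i => Set.Ioc ((0 : Fin s → ℝ) i) ((1 : Fin s → ℝ) i) := by
    ext x; simp
  have h2 := Measure.univ_pi_Ioc_ae_eq_Icc (μ := fun _ : Fin s => (volume : Measure ℝ))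
    (f := (0 : Fin s → ℝ)) (g := (1 : Fin s → ℝ))
  rw [← volume_pi] at h2
  rw [h1, Measure.restrict_congr_set h2]
  simp only [neg_zero, UnitAddTorus.mFourier_zero, ContinuousMap.one_apply, one_smul]
  rfl

lemma tsum_mul_le_rpow_mul_rpow {ι : Type*} (f g : ι → ℝ≥0∞) :
    ∑' i, f i * g i ≤ (∑' i, f i ^ 2) ^ (1 / 2 : ℝ) * (∑' i, g i ^ 2) ^ (1 / 2 : ℝ) := by
  let _ : MeasurableSpace ι := ⊤
  have := ENNReal.lintegral_mul_le_Lp_mul_Lq (Measure.count : Measure ι)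
    (p := 2) (q := 2) (by constructor <;> norm_num) (f := f) (g := g)
    measurable_from_top.aemeasurable measurable_from_top.aemeasurable
  simpa [lintegral_count' measurable_from_top] using this

/-- Cauchy–Schwarz for the splitting a = r^{1/2} · (r^{-1/2} a) on `L`. With `L` everything it gives
absolute convergence of Fourier series in the ball; with `L` the dual lattice it gives the error
bound. -/
lemma tsum_enorm_le {ι : Type*} (r a : ι → ℝ≥0∞) (hr : ∀ i, r i ≠ 0) (hr' : ∀ i, r i ≠ ⊤)
    (ha : ∑' i, (r i)⁻¹ * a i ^ 2 ≤ 1) (L : Set ι) :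
    ∑' i, L.indicator a i ≤ (∑' i, L.indicator r i) ^ (1 / 2 : ℝ) := by
  have h2 : ∀ x : ℝ≥0∞, (x ^ (1 / 2 : ℝ)) ^ 2 = x := fun x => by
    rw [← ENNReal.rpow_natCast, ← ENNReal.rpow_mul]; norm_num
  have key := tsum_mul_le_rpow_mul_rpow (fun i => (L.indicator r i) ^ (1 / 2 : ℝ))
    (fun i => ((r i)⁻¹) ^ (1 / 2 : ℝ) * a i)
  simp only [mul_pow, h2] at key
  refine le_trans (le_of_eq (tsum_congr fun i => ?_)) (key.trans ?_)
  · by_cases hi : i ∈ L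
    · simp only [Set.indicator_of_mem hi]
      rw [← mul_assoc, ← ENNReal.mul_rpow_of_nonneg _ _ (by norm_num : (0 : ℝ) ≤ 1 / 2),
        ENNReal.mul_inv_cancel (hr i) (hr' i)]
      simp
    · simp [Set.indicator_of_notMem hi]
  · calc _ ≤ (∑' i, L.indicator r i) ^ (1 / 2 : ℝ) * (1 : ℝ≥0∞) ^ (1 / 2 : ℝ) := by gcongr
      _ = _ := by simp

lemma summable_mFourierCoeff {α : ℝ} {γ : Finset ℕ → ℝ} (hγ : ∀ u, 0 < γ u) {s : ℕ}
    (hfin : ∑' h : Fin s → ℤ, freqWeight α γ h ≠ ⊤)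
    {f : C(UnitAddTorus (Fin s), ℂ)} (hf : f ∈ korobovBall α γ s) :
    Summable (UnitAddTorus.mFourierCoeff f) := by
  have hf' : korobovNormSq α γ f ≤ 1 := hf
  rw [korobovNormSq_eq hγ] at hf'
  have := tsum_enorm_le _ _ (freqWeight_ne_zero hγ) freqWeight_ne_top hf' Set.univ
  simp only [Set.indicator_univ] at this
  have h3 : ∑' h, ‖UnitAddTorus.mFourierCoeff f h‖ₑ ≠ ⊤ :=
    ne_top_of_le_ne_top (ENNReal.rpow_ne_top_of_nonneg (by norm_num) hfin) this
  refine Summable.of_norm ?_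
  have h4 := ENNReal.summable_toReal h3
  simpa using h4

lemma mFourier_latticePoints {N s : ℕ} (z h : Fin s → ℤ) (k : Fin N) :
    UnitAddTorus.mFourier h (toTorus (latticePoints N z k)) =
      Complex.exp (2 * Real.pi * Complex.I * (∑ j, h j * z j : ℤ) / N) ^ (k : ℕ) := by
  have h1 : ∀ j, (fourier (h j) : UnitAddCircle → ℂ) (toTorus (latticePoints N z k) j) =
      Complex.exp (2 * Real.pi * Complex.I * (h j * z j : ℤ) / N * (k : ℕ)) := by
    intro j
    have : toTorus (latticePoints N z k) j =
        ((((k : ℕ) : ℝ) * (z j : ℝ) / (N : ℝ) : ℝ) : UnitAddCircle) := by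
      simp only [toTorus, latticePoints]
      rw [Int.fract, AddCircle.coe_sub]
      have : ((⌊((k : ℕ) : ℝ) * (z j : ℝ) / (N : ℝ)⌋ : ℝ) : UnitAddCircle) = 0 := by
        rw [AddCircle.coe_eq_zero_iff]
        exact ⟨⌊((k : ℕ) : ℝ) * (z j : ℝ) / (N : ℝ)⌋, by simp⟩
      rw [this, sub_zero]
    rw [this, fourier_coe_apply]
    congr 1
    push_cast
    ring
  simp only [UnitAddTorus.mFourier, ContinuousMap.coe_mk]
  rw [Finset.prod_congr rfl fun j _ => h1 j, ← Complex.exp_sum, ← Complex.exp_nat_mul]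
  congr 1
  push_cast
  rw [Finset.mul_sum, Finset.sum_div, Finset.mul_sum]
  exact Finset.sum_congr rfl fun j _ => by ring

/-- Along the lattice points a character runs through the powers of an N-th root of unity, so its
average is a geometric sum. -/
lemma sum_mFourier_latticePoints {N s : ℕ} (hN : 0 < N) (z h : Fin s → ℤ) :
    (1 / (N : ℂ)) * ∑ k : Fin N, UnitAddTorus.mFourier h (toTorus (latticePoints N z k)) =
      if (N : ℤ) ∣ ∑ j, h j * z j then 1 else 0 := by
  have hN' : (N : ℂ) ≠ 0 := by exact_mod_cast hN.ne'
  simp only [mFourier_latticePoints]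
  set ω := Complex.exp (2 * Real.pi * Complex.I * (∑ j, h j * z j : ℤ) / N) with hω
  have hpi : (2 * Real.pi * Complex.I : ℂ) ≠ 0 := Complex.two_pi_I_ne_zero
  have hωN : ω ^ N = 1 := by
    rw [hω, ← Complex.exp_nat_mul, Complex.exp_eq_one_iff]
    exact ⟨_, by field_simp⟩
  have hiff : ω = 1 ↔ (N : ℤ) ∣ ∑ j, h j * z j := by
    rw [hω, Complex.exp_eq_one_iff]
    constructor
    · rintro ⟨n, hn⟩
      refine ⟨n, ?_⟩
      field_simp at hn
      have : ((∑ j, h j * z j : ℤ) : ℂ) = ((N * n : ℤ) : ℂ) := by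
        push_cast at hn ⊢
        exact hn
      exact_mod_cast this
    · rintro ⟨n, hn⟩
      refine ⟨n, ?_⟩
      rw [hn]
      push_cast
      field_simp
  rw [Fin.sum_univ_eq_sum_range (fun k => ω ^ k) N]
  split_ifs with hd
  · rw [hiff.2 hd]; simp [hN']
  · have : ω ≠ 1 := fun e => hd (hiff.1 e)
    rw [geom_sum_eq this, hωN]; simp

/-- Applying the rule termwise to the absolutely convergent Fourier series leaves only dual
frequencies; the integral cancels the frequency 0. -/
lemma enorm_error_le {α : ℝ} {γ : Finset ℕ → ℝ} (hγ : ∀ u, 0 < γ u) {N s : ℕ} (hN : 0 < N)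
    (hfin : ∑' h : Fin s → ℤ, freqWeight α γ h ≠ ⊤) (z : Fin s → ℤ)
    {f : C(UnitAddTorus (Fin s), ℂ)} (hf : f ∈ korobovBall α γ s) :
    ‖(∫ t in Set.Icc (0 : Fin s → ℝ) 1, f (toTorus t)) -
      (1 / (N : ℂ)) * ∑ n : Fin N, f (toTorus (latticePoints N z n))‖ₑ ≤
    (∑' h, (dualLattice N z).indicator (freqWeight α γ) h) ^ (1 / 2 : ℝ) := by
  have hs := summable_mFourierCoeff hγ hfin hf
  have h1 : HasSum (fun h => UnitAddTorus.mFourierCoeff f h *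
      if (N : ℤ) ∣ ∑ j, h j * z j then 1 else 0)
      ((1 / (N : ℂ)) * ∑ n : Fin N, f (toTorus (latticePoints N z n))) := by
    have := (hasSum_sum (s := Finset.univ) fun n _ =>
      UnitAddTorus.hasSum_mFourier_series_apply_of_summable hs
        (toTorus (latticePoints N z n))).mul_left (1 / (N : ℂ))
    refine this.congr_fun fun h => ?_
    rw [← sum_mFourier_latticePoints hN]
    simp only [smul_eq_mul, Finset.mul_sum]
    exact Finset.sum_congr rfl fun _ _ => by ring
  have h0 : HasSum (fun h : Fin s → ℤ => if h = 0 then UnitAddTorus.mFourierCoeff f 0 else 0)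
      (UnitAddTorus.mFourierCoeff f 0) := by
    exact hasSum_ite_eq (0 : Fin s → ℤ) (UnitAddTorus.mFourierCoeff f 0)
  rw [integral_toTorus, ← (h0.sub h1).tsum_eq]
  refine enorm_tsum_le_tsum_enorm.trans ?_
  have hf' : korobovNormSq α γ f ≤ 1 := hf
  rw [korobovNormSq_eq hγ] at hf'
  refine le_trans (ENNReal.tsum_le_tsum fun h => ?_)
    (tsum_enorm_le _ _ (freqWeight_ne_zero hγ) freqWeight_ne_top hf' (dualLattice N z))
  by_cases h00 : h = 0
  · subst h00; simp
  · by_cases hd : (N : ℤ) ∣ ∑ j, h j * z j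
    · have : h ∈ dualLattice N z := ⟨h00, hd⟩
      simp [h00, hd, this]
    · simp [h00, hd]

/-- The trigonometric polynomial with frequencies in `F` and coefficients `c`. -/
def trigPoly {s : ℕ} (F : Finset (Fin s → ℤ)) (c : (Fin s → ℤ) → ℂ) :
    C(UnitAddTorus (Fin s), ℂ) :=
  ∑ h ∈ F, c h • UnitAddTorus.mFourier h

lemma mFourierCoeff_trigPoly {s : ℕ} (F : Finset (Fin s → ℤ)) (c : (Fin s → ℤ) → ℂ)
    (k : Fin s → ℤ) :
    UnitAddTorus.mFourierCoeff (trigPoly F c) k = if k ∈ F then c k else 0 := by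
  classical
  rw [← UnitAddTorus.mFourierCoeff_toLp, ← UnitAddTorus.mFourierBasis_repr, trigPoly, map_sum,
    map_sum]
  -- Orthonormality of the characters enters through the Hilbert basis of L².
  have : ∀ h : Fin s → ℤ, UnitAddTorus.mFourierBasis.repr (UnitAddTorus.mFourierLp 2 h) =
      lp.single 2 h (1 : ℂ) := fun h => by
    rw [← UnitAddTorus.coe_mFourierBasis]
    exact HilbertBasis.repr_self _ h
  rw [lp.coeFn_sum, Finset.sum_apply]
  rw [Finset.sum_congr rfl fun h _ => by
    rw [ContinuousLinearMap.map_smul, LinearIsometryEquiv.map_smul, this h, lp.coeFn_smul,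
      Pi.smul_apply, lp.single_apply]]
  simp [Pi.single_apply]

lemma trigPoly_mem_korobovBall {α : ℝ} {γ : Finset ℕ → ℝ} (hγ : ∀ u, 0 < γ u) {s : ℕ}
    (F : Finset (Fin s → ℤ)) (c : (Fin s → ℤ) → ℂ)
    (hc : ∑ h ∈ F, (freqWeight α γ h)⁻¹ * ‖c h‖ₑ ^ 2 ≤ 1) :
    trigPoly F c ∈ korobovBall α γ s := by
  change korobovNormSq α γ _ ≤ 1
  rw [korobovNormSq_eq hγ, tsum_eq_sum (s := F)]
  · refine le_trans (le_of_eq (Finset.sum_congr rfl fun h hh => ?_)) hc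
    rw [mFourierCoeff_trigPoly, if_pos hh]
  · intro h hh
    rw [mFourierCoeff_trigPoly, if_neg hh]
    simp

lemma one_le_initialError {α : ℝ} {γ : Finset ℕ → ℝ} (hγ : ∀ u, 0 < γ u) (hγ_empty : γ ∅ = 1)
    (s : ℕ) : 1 ≤ initialError α γ s := by
  have hm : trigPoly {(0 : Fin s → ℤ)} (fun _ => 1) ∈ korobovBall α γ s := by
    refine trigPoly_mem_korobovBall hγ _ _ ?_
    simp [freqWeight, decay, freqSupport, hγ_empty]
  unfold initialError
  refine le_trans ?_ (le_iSup₂ (f := fun f (_ : f ∈ korobovBall α γ s) =>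
    ‖∫ t in Set.Icc (0 : Fin s → ℝ) 1, f (toTorus t)‖ₑ) _ hm)
  simp only [integral_toTorus, mFourierCoeff_trigPoly]
  simp

/-- The test function is the error representer truncated to `F`, up to sign and normalization. With
coefficients t·r_h and t = R^{-1/2} its squared norm is t²R = 1 and its error is tR = R^{1/2}.
Finiteness of `F` makes it a trigonometric polynomial. -/
lemma sum_le_latticeError_sq {α : ℝ} {γ : Finset ℕ → ℝ} (hγ : ∀ u, 0 < γ u) {N s : ℕ}
    (hN : 0 < N) (z : Fin s → ℤ) (F : Finset (Fin s → ℤ)) (hF : ∀ h ∈ F, h ∈ dualLattice N z) :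
    ∑ h ∈ F, freqWeight α γ h ≤ latticeError α γ N z ^ 2 := by
  set R : ℝ≥0∞ := ∑ h ∈ F, freqWeight α γ h with hR
  by_cases hR0 : R = 0
  · simp [hR0]
  have hRtop : R ≠ ⊤ := ENNReal.sum_ne_top.2 fun h _ => freqWeight_ne_top h
  set t : ℝ := (R.toReal) ^ (-(1 / 2) : ℝ) with ht
  have hRpos : 0 < R.toReal := ENNReal.toReal_pos hR0 hRtop
  have htpos : 0 < t := Real.rpow_pos_of_pos hRpos _
  set c : (Fin s → ℤ) → ℂ := fun h => ((t * (freqWeight α γ h).toReal : ℝ) : ℂ) with hc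
  have hcn : ∀ h, ‖c h‖ₑ = ENNReal.ofReal t * freqWeight α γ h := fun h => by
    rw [← ofReal_norm, hc, Complex.norm_real, Real.norm_of_nonneg (by positivity),
      ENNReal.ofReal_mul htpos.le, ENNReal.ofReal_toReal (freqWeight_ne_top h)]
  have ht2 : ENNReal.ofReal t ^ 2 * R = 1 := by
    rw [← ENNReal.ofReal_pow htpos.le, ← ENNReal.ofReal_toReal hRtop,
      ← ENNReal.ofReal_mul (by positivity), ht, ← Real.rpow_natCast, ← Real.rpow_mul hRpos.le]
    norm_num
    rw [Real.rpow_neg_one, inv_mul_cancel₀ hRpos.ne']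
  have hmem : trigPoly F c ∈ korobovBall α γ s := by
    refine trigPoly_mem_korobovBall hγ _ _ (le_of_eq ?_)
    rw [← ht2, hR, Finset.mul_sum]
    refine Finset.sum_congr rfl fun h _ => ?_
    rw [hcn, mul_pow, sq (freqWeight α γ h), mul_left_comm, ← mul_assoc (_)⁻¹,
      ENNReal.inv_mul_cancel (freqWeight_ne_zero hγ h) (freqWeight_ne_top h), one_mul]
  have hle : ENNReal.ofReal t * R ≤ latticeError α γ N z := by
    unfold latticeError worstCaseError
    refine le_trans (le_of_eq ?_) (le_iSup₂ (f := fun f (_ : f ∈ korobovBall α γ s) =>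
      ‖(∫ t in Set.Icc (0 : Fin s → ℝ) 1, f (toTorus t)) -
        (1 / (N : ℂ)) * ∑ n : Fin N, f (toTorus (latticePoints N z n))‖ₑ) _ hmem)
    have h0 : (0 : Fin s → ℤ) ∉ F := fun h0 => (hF 0 h0).1 rfl
    have h1 : (1 / (N : ℂ)) * ∑ n : Fin N, trigPoly F c (toTorus (latticePoints N z n)) =
        ∑ h ∈ F, c h := by
      simp only [trigPoly, ContinuousMap.coe_sum, Finset.sum_apply, ContinuousMap.coe_smul,
        Pi.smul_apply, smul_eq_mul]
      rw [Finset.sum_comm, Finset.mul_sum]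
      refine Finset.sum_congr rfl fun h hh => ?_
      rw [← Finset.mul_sum, mul_left_comm, sum_mFourier_latticePoints hN, if_pos (hF h hh).2,
        mul_one]
    rw [integral_toTorus, mFourierCoeff_trigPoly, if_neg h0, h1, zero_sub, enorm_neg, hc,
      ← Complex.ofReal_sum, ← Finset.mul_sum, ← ofReal_norm, Complex.norm_real,
      Real.norm_of_nonneg (by positivity), ENNReal.ofReal_mul htpos.le,
      ← ENNReal.toReal_sum (fun h _ => freqWeight_ne_top h), ENNReal.ofReal_toReal hRtop]
  calc R = (ENNReal.ofReal t * R) ^ 2 := by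
        rw [mul_pow, sq R, ← mul_assoc, ht2, one_mul]
    _ ≤ _ := by gcongr

lemma latticeError_sq {α : ℝ} {γ : Finset ℕ → ℝ} (hγ : ∀ u, 0 < γ u) {N s : ℕ} (hN : 0 < N)
    (hfin : ∑' h : Fin s → ℤ, freqWeight α γ h ≠ ⊤) (z : Fin s → ℤ) :
    latticeError α γ N z ^ 2 = ∑' h, (dualLattice N z).indicator (freqWeight α γ) h := by
  classical
  apply le_antisymm
  · have : latticeError α γ N z ≤
        (∑' h, (dualLattice N z).indicator (freqWeight α γ) h) ^ (1 / 2 : ℝ) :=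
      iSup₂_le fun f hf => enorm_error_le hγ hN hfin z hf
    calc _ ≤ ((∑' h, (dualLattice N z).indicator (freqWeight α γ) h) ^ (1 / 2 : ℝ)) ^ 2 := by
          gcongr
      _ = _ := by rw [← ENNReal.rpow_natCast, ← ENNReal.rpow_mul]; norm_num
  · rw [ENNReal.tsum_eq_iSup_sum]
    refine iSup_le fun F => ?_
    refine le_trans (le_of_eq ?_) (sum_le_latticeError_sq hγ hN z
      (F.filter (· ∈ dualLattice N z)) fun h hh => (Finset.mem_filter.1 hh).2)
    rw [Finset.sum_filter]
    exact Finset.sum_congr rfl fun h _ => by simp [Set.indicator_apply]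

/-! ### Frequency sums, zeta values and subadditivity of powers. -/

/-- The sum of `|k|^{-x}` over all nonzero integers `k`. -/
def kernelSum (x : ℝ) : ℝ≥0∞ := ∑' k : ℤ, if k = 0 then 0 else decay x k

lemma hasSum_zetaReal {x : ℝ} (hx : 1 < x) :
    HasSum (fun n : ℕ => ((n : ℝ) + 1) ^ (-x)) (zetaReal x) := by
  have hs : Summable fun n : ℕ => ((n : ℝ) + 1) ^ (-x) := by
    have := (summable_nat_add_iff 1).2 (Real.summable_nat_rpow (p := -x) |>.2 (by linarith))
    simpa using this
  have hz := zeta_eq_tsum_one_div_nat_add_one_cpow (s := (x : ℂ)) (by simpa using hx)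
  have : ∀ n : ℕ, 1 / ((n : ℂ) + 1) ^ (x : ℂ) = ((((n : ℝ) + 1) ^ (-x) : ℝ) : ℂ) := fun n => by
    rw [Complex.ofReal_cpow (by positivity)]
    push_cast
    rw [Complex.cpow_neg, one_div]
  simp only [this, ← Complex.ofReal_tsum] at hz
  rw [zetaReal, hz, Complex.ofReal_re]
  exact hs.hasSum

lemma zetaReal_pos {x : ℝ} (hx : 1 < x) : 0 < zetaReal x :=
  lt_of_lt_of_le one_pos <| by
    simpa using le_hasSum (hasSum_zetaReal hx) 0 fun n _ => by positivity

lemma kernelSum_eq {x : ℝ} (hx : 1 < x) : kernelSum x = ENNReal.ofReal (2 * zetaReal x) := by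
  have h1 : ∑' n : ℕ, ENNReal.ofReal (((n : ℝ) + 1) ^ (-x)) = ENNReal.ofReal (zetaReal x) := by
    rw [← (hasSum_zetaReal hx).tsum_eq,
      ENNReal.ofReal_tsum_of_nonneg (fun n => by positivity) (hasSum_zetaReal hx).summable]
  have hd : ∀ n : ℕ, |(n : ℝ) + 1| = (n : ℝ) + 1 := fun n => abs_of_pos (by positivity)
  have hA : HasSum (fun n : ℕ => if (n : ℤ) + 1 = 0 then 0 else decay x ((n : ℤ) + 1))
      (ENNReal.ofReal (zetaReal x)) := by
    rw [← h1]
    refine ENNReal.summable.hasSum.congr_fun fun n => ?_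
    have hn : (n : ℤ) + 1 ≠ 0 := by omega
    simp [decay, hn, hd]
  have hB : HasSum (fun n : ℕ => if -((n : ℤ) + 1) = 0 then 0 else decay x (-((n : ℤ) + 1)))
      (ENNReal.ofReal (zetaReal x)) := by
    rw [← h1]
    refine ENNReal.summable.hasSum.congr_fun fun n => ?_
    have hn : -((n : ℤ) + 1) ≠ 0 := by omega
    rw [if_neg hn, decay, if_neg hn, Int.cast_neg, abs_neg]
    simp [hd]
  have := HasSum.of_add_one_of_neg_add_one (f := fun k : ℤ => if k = 0 then 0 else decay x k) hA hB
  simp only [if_true, add_zero] at this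
  rw [kernelSum, this.tsum_eq, two_mul, ENNReal.ofReal_add (zetaReal_pos hx).le (zetaReal_pos hx).le]

lemma tsum_snoc {d : ℕ} (F : (Fin (d + 1) → ℤ) → ℝ≥0∞) :
    ∑' h, F h = ∑' h : Fin d → ℤ, ∑' k : ℤ, F (Fin.snoc h k) := by
  rw [← (Fin.snocEquiv (fun _ : Fin (d + 1) => ℤ)).tsum_eq F, ENNReal.tsum_prod',
    ENNReal.tsum_comm]
  rfl

lemma freqSupport_snoc {d : ℕ} (h : Fin d → ℤ) (k : ℤ) :
    freqSupport (Fin.snoc h k : Fin (d + 1) → ℤ) =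
      if k = 0 then freqSupport h else insert d (freqSupport h) := by
  ext n
  by_cases hk : k = 0
  · simp [freqSupport, Fin.exists_iff_castSucc, hk]
  · simp [freqSupport, Fin.exists_iff_castSucc, hk, eq_comm]

lemma prod_decay_snoc {d : ℕ} (x : ℝ) (h : Fin d → ℤ) (k : ℤ) :
    ∏ j, decay x ((Fin.snoc h k : Fin (d + 1) → ℤ) j) = (∏ j, decay x (h j)) * decay x k := by
  rw [Fin.prod_univ_castSucc]
  simp

lemma tsum_ite_eq_zero (F G : ℤ → ℝ≥0∞) :
    ∑' k, (if k = 0 then F k else G k) = F 0 + ∑' k, if k = 0 then 0 else G k := by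
  rw [← tsum_ite_eq (0 : ℤ) (fun _ => F 0), ← ENNReal.tsum_add]
  refine tsum_congr fun k => ?_
  by_cases hk : k = 0 <;> simp [hk]

/-- Frequencies are grouped by support, each active coordinate contributing one factor `kernelSum
x`. The function `c` is arbitrary because the induction step applies the hypothesis also to `c
(insert d ·)`. -/
lemma tsum_freqSupport (x : ℝ) (d : ℕ) (c : Finset ℕ → ℝ≥0∞) :
    ∑' h : Fin d → ℤ, c (freqSupport h) * ∏ j, decay x (h j) =
      ∑ v ∈ (Finset.range d).powerset, c v * kernelSum x ^ v.card := by
  induction d generalizing c with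
  | zero => simp [freqSupport]
  | succ d ih =>
    have key : ∀ h : Fin d → ℤ,
        ∑' k : ℤ, c (freqSupport (Fin.snoc h k : Fin (d + 1) → ℤ)) *
          ∏ j, decay x ((Fin.snoc h k : Fin (d + 1) → ℤ) j) =
        c (freqSupport h) * ∏ j, decay x (h j) +
          (c (insert d (freqSupport h)) * kernelSum x) * ∏ j, decay x (h j) := by
      intro h
      have : ∀ k : ℤ, c (freqSupport (Fin.snoc h k : Fin (d + 1) → ℤ)) *
          ∏ j, decay x ((Fin.snoc h k : Fin (d + 1) → ℤ) j) =
          if k = 0 then c (freqSupport h) * ∏ j, decay x (h j) else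
            c (insert d (freqSupport h)) * (∏ j, decay x (h j)) * decay x k := fun k => by
        rw [freqSupport_snoc, prod_decay_snoc]
        split_ifs with hk
        · simp [hk, decay]
        · ring
      simp only [this]
      rw [tsum_ite_eq_zero (fun _ => c (freqSupport h) * ∏ j, decay x (h j)), kernelSum,
        mul_right_comm, ← ENNReal.tsum_mul_left]
      simp only [mul_ite, mul_zero]
    rw [tsum_snoc]
    simp only [key]
    rw [ENNReal.tsum_add, ih, ih (fun v => c (insert d v) * kernelSum x), Finset.range_add_one,
      Finset.sum_powerset_insert (by simp)]
    congr 1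
    refine Finset.sum_congr rfl fun v hv => ?_
    have : d ∉ v := fun hd => by simpa using Finset.mem_powerset.1 hv hd
    rw [Finset.card_insert_of_notMem this, pow_succ]
    ring

lemma tsum_freqWeight_ne_top {α : ℝ} (hα : 1 < α) (γ : Finset ℕ → ℝ) (s : ℕ) :
    ∑' h : Fin s → ℤ, freqWeight α γ h ≠ ⊤ := by
  unfold freqWeight
  rw [tsum_freqSupport α s (fun u => ENNReal.ofReal (γ u))]
  refine ENNReal.sum_ne_top.2 fun u _ => ENNReal.mul_ne_top ENNReal.ofReal_ne_top ?_
  rw [kernelSum_eq hα]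
  exact ENNReal.pow_ne_top ENNReal.ofReal_ne_top

lemma tsum_rpow_le {ι : Type*} (a : ι → ℝ≥0∞) {p : ℝ} (hp : 0 < p) (hp1 : p ≤ 1) :
    (∑' i, a i) ^ p ≤ ∑' i, a i ^ p := by
  have hfin : ∀ F : Finset ι, (∑ i ∈ F, a i) ^ p ≤ ∑ i ∈ F, a i ^ p := by
    classical
    intro F
    induction F using Finset.induction_on with
    | empty => simp [hp]
    | insert i F hi ih =>
      rw [Finset.sum_insert hi, Finset.sum_insert hi]
      exact (ENNReal.rpow_add_le_add_rpow _ _ hp.le hp1).trans (by gcongr)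
  rw [← ENNReal.le_rpow_inv_iff hp, ENNReal.tsum_eq_iSup_sum]
  refine iSup_le fun F => ?_
  rw [ENNReal.le_rpow_inv_iff hp]
  exact (hfin F).trans (ENNReal.sum_le_tsum F)

lemma decay_rpow (x p : ℝ) (k : ℤ) (hp : 0 ≤ p) : decay x k ^ p = decay (x * p) k := by
  unfold decay
  split_ifs with hk
  · simp
  · rw [ENNReal.ofReal_rpow_of_nonneg (by positivity) hp, ← Real.rpow_mul (abs_nonneg _)]
    congr 2
    ring

/-! ### Counting in the search space -/

/-- Two solutions agree modulo M' = M / gcd(k, M), so among the integers in [0, M) a solution is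
determined by its quotient by M', which takes at most gcd(k, M) values. -/
lemma card_linear_congruence_le {M : ℕ} (hM : 0 < M) (A k : ℤ) (Z : Finset ℕ)
    (hZ : ∀ y ∈ Z, y < M) :
    (Z.filter fun y : ℕ => (M : ℤ) ∣ A + k * (y : ℤ)).card ≤ Int.gcd k M := by
  set g := Int.gcd k M with hg
  have hgpos : 0 < g := Int.gcd_pos_of_ne_zero_right _ (by exact_mod_cast hM.ne')
  obtain ⟨M', hM'⟩ : g ∣ M := Int.natCast_dvd_natCast.1 (Int.gcd_dvd_right _ _)
  have hM'pos : 0 < M' := Nat.pos_of_ne_zero fun h => by simp [h] at hM'; omega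
  rw [← Finset.card_range g]
  refine Finset.card_le_card_of_injOn (fun y : ℕ => y / M') ?_ ?_
  · intro y hy
    have hy := Finset.mem_filter.1 hy
    have := hZ y hy.1
    simp only [Finset.coe_range, Set.mem_Iio]
    exact Nat.div_lt_of_lt_mul (by rw [mul_comm]; omega)
  · intro y hy y' hy' hyy
    have hy := (Finset.mem_filter.1 hy).2
    have hy' := (Finset.mem_filter.1 hy').2
    have h1 : (M : ℤ) ∣ k * ((y : ℤ) - y') := by
      have := dvd_sub hy hy'
      ring_nf at this ⊢
      exact this
    obtain ⟨k', hk'⟩ : (g : ℤ) ∣ k := Int.gcd_dvd_left _ _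
    have hcop : IsCoprime (M' : ℤ) k' := by
      rw [Int.isCoprime_iff_gcd_eq_one, Int.gcd_comm]
      have : g * Int.gcd k' M' = g * 1 := by
        rw [mul_one]
        conv_rhs => rw [hg, hk', hM']
        push_cast
        rw [Int.gcd_mul_left]
        simp
      exact Nat.eq_of_mul_eq_mul_left hgpos this
    have h2 : (M' : ℤ) ∣ (y : ℤ) - y' := by
      rw [hk', hM', mul_assoc] at h1
      push_cast at h1
      exact hcop.dvd_of_dvd_mul_left
        ((mul_dvd_mul_iff_left (by exact_mod_cast hgpos.ne')).1 h1)
    have h3 : y % M' = y' % M' := by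
      have := Int.ModEq.symm (Int.modEq_iff_dvd.2 h2)
      exact_mod_cast this
    rw [← Nat.div_add_mod y M', ← Nat.div_add_mod y' M', h3]
    simp only at hyy
    rw [hyy]

/-- For v < m the search space has at least φ(b^{m-v}) elements, and b ≤ 2(b - 1) gives φ(b^{m-v}) ≥
b^{m-v}/2. This is the source of the factor 2 in the error bound. -/
lemma pow_le_card_searchSet {b : ℕ} (hb : b.Prime) (m v : ℕ) :
    b ^ m ≤ 2 * (searchSet b m v).card * b ^ v := by
  unfold searchSet
  split_ifs with hv
  · obtain ⟨n, rfl⟩ : ∃ n, m = v + (n + 1) := ⟨m - v - 1, by omega⟩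
    have hsub : ((Finset.range (b ^ (n + 1))).filter fun a => (b ^ (n + 1)).Coprime a) ⊆
        (Finset.Icc 1 (b ^ (v + (n + 1) - v) - 1)).filter
          fun z => Nat.gcd z (b ^ (v + (n + 1))) = 1 := by
      intro a ha
      simp only [Finset.mem_filter, Finset.mem_range, Finset.mem_Icc, Nat.add_sub_cancel_left]
        at ha ⊢
      have hc : b.Coprime a := Nat.Coprime.coprime_dvd_left (dvd_pow_self b (by omega)) ha.2
      refine ⟨⟨Nat.pos_of_ne_zero ?_, by omega⟩, (hc.pow_left _).symm⟩
      rintro rfl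
      rw [Nat.coprime_zero_right] at hc
      exact hb.one_lt.ne' hc
    have hcard := Finset.card_le_card hsub
    rw [← Nat.totient_eq_card_coprime, Nat.totient_prime_pow_succ hb] at hcard
    have h2 : b ≤ 2 * (b - 1) := by have := hb.two_le; omega
    calc b ^ (v + (n + 1)) = b ^ n * b * b ^ v := by ring
      _ ≤ b ^ n * (2 * (b - 1)) * b ^ v := by gcongr
      _ = 2 * (b ^ n * (b - 1)) * b ^ v := by ring
      _ ≤ _ := by gcongr
  · have : b ^ m ≤ b ^ v := Nat.pow_le_pow_right hb.pos (by omega)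
    simp only [Finset.card_singleton]
    omega

lemma searchSet_coprime {b m v y : ℕ} (hv : v < m) (hy : y ∈ searchSet b m v) :
    y < b ^ (m - v) ∧ Nat.Coprime y (b ^ m) := by
  rw [searchSet, if_pos hv, Finset.mem_filter, Finset.mem_Icc] at hy
  exact ⟨by omega, hy.2⟩

/-- Writing k = gl produces the factor g · g^{-x} ≤ 1: the sparsity of the multiples of g pays for a
multiplicity g. -/
lemma tsum_multiples_le {x : ℝ} (hx : 1 < x) {g : ℕ} (hg : 0 < g) :
    ∑' k : ℤ, (if k ≠ 0 ∧ (g : ℤ) ∣ k then (g : ℝ≥0∞) * decay x k else 0) ≤ kernelSum x := by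
  have hg' : (g : ℤ) ≠ 0 := by exact_mod_cast hg.ne'
  have hinj : Function.Injective fun l : ℤ => (g : ℤ) * l := fun a c h => by
    exact mul_left_cancel₀ hg' h
  rw [← hinj.tsum_eq]
  · refine ENNReal.tsum_le_tsum fun l => ?_
    by_cases hl : l = 0
    · simp [hl]
    · have hle : (g : ℝ) * |((g : ℝ) * (l : ℝ))| ^ (-x) ≤ |(l : ℝ)| ^ (-x) := by
        have hgr : (1 : ℝ) ≤ g := by exact_mod_cast hg
        rw [abs_mul, Nat.abs_cast, Real.mul_rpow (by positivity) (abs_nonneg _), ← mul_assoc]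
        have : (g : ℝ) * (g : ℝ) ^ (-x) ≤ 1 := by
          nth_rewrite 1 [← Real.rpow_one (g : ℝ)]
          rw [← Real.rpow_add (by linarith)]
          exact Real.rpow_le_one_of_one_le_of_nonpos hgr (by linarith)
        exact mul_le_of_le_one_left (by positivity) this
      simp only [ne_eq, mul_eq_zero, hg', hl, or_self, not_false_eq_true, dvd_mul_right, and_self,
        if_true, if_false, decay]
      rw [← ENNReal.ofReal_natCast g, ← ENNReal.ofReal_mul (by positivity)]
      refine ENNReal.ofReal_le_ofReal ?_
      push_cast
      exact hle
  · intro k hk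
    rw [Function.mem_support] at hk
    by_contra hcon
    apply hk
    rw [if_neg]
    rintro ⟨_, l, hl⟩
    exact hcon ⟨l, hl.symm⟩

/-- For v < m a solution forces b^v ∣ A, and dividing by b^v leaves M ∣ A' + ky with M = b^{m-v}.
Since y is a unit modulo M, solvability forces gcd(k, M) = gcd(A', M) =: g, independent of k. So
only multiples of g contribute, each with at most g solutions y. For v ≥ m there is a single y and
nothing to average. -/
lemma sum_searchSet_le {b : ℕ} (hb : b.Prime) (m v : ℕ) {x : ℝ} (hx : 1 < x) (A : ℤ) :
    ∑ y ∈ searchSet b m v, ∑' k : ℤ,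
      (if k ≠ 0 ∧ ((b ^ m : ℕ) : ℤ) ∣ A + k * ((b ^ v * y : ℕ) : ℤ) then decay x k else 0) ≤
    kernelSum x := by
  by_cases hv : v < m
  · by_cases hA : ((b ^ v : ℕ) : ℤ) ∣ A
    · obtain ⟨A', rfl⟩ := hA
      set M := b ^ (m - v) with hM
      have hMpos : 0 < M := pow_pos hb.pos _
      have hbv : ((b ^ v : ℕ) : ℤ) ≠ 0 := by exact_mod_cast (pow_pos hb.pos v).ne'
      have hmM : b ^ m = b ^ v * M := by rw [hM, ← pow_add]; congr 1; omega
      have hiff : ∀ (k : ℤ) (y : ℕ),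
          (((b ^ m : ℕ) : ℤ) ∣ ((b ^ v : ℕ) : ℤ) * A' + k * ((b ^ v * y : ℕ) : ℤ)) ↔
            (M : ℤ) ∣ A' + k * (y : ℤ) := fun k y => by
        rw [hmM, Nat.cast_mul, Nat.cast_mul, mul_left_comm k, ← mul_add,
          mul_dvd_mul_iff_left hbv]
      have hgpos : 0 < Int.gcd A' M :=
        Int.gcd_pos_of_ne_zero_right _ (by exact_mod_cast hMpos.ne')
      rw [← Summable.tsum_finsetSum fun _ _ => ENNReal.summable]
      refine le_trans (ENNReal.tsum_le_tsum fun k => ?_) (tsum_multiples_le hx hgpos)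
      simp only [hiff]
      by_cases hk : k = 0
      · simp [hk]
      simp only [ne_eq, hk, not_false_eq_true, true_and]
      rw [← Finset.sum_filter, Finset.sum_const, nsmul_eq_mul]
      rcases ((searchSet b m v).filter fun y : ℕ => (M : ℤ) ∣ A' + k * (y : ℤ)).eq_empty_or_nonempty
        with he | ⟨y, hy⟩
      · simp [he]
      · rw [Finset.mem_filter] at hy
        have hyM : IsCoprime (y : ℤ) (M : ℤ) := by
          rw [Nat.isCoprime_iff_coprime]
          exact Nat.Coprime.coprime_dvd_right ⟨b ^ v, by rw [hmM, mul_comm]⟩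
            (searchSet_coprime hv hy.1).2
        -- As y is invertible modulo every divisor of M, A' and k have the same common divisors with
        -- M.
        have hgcd : ∀ g : ℤ, g ∣ M → (g ∣ A' ↔ g ∣ k) := fun g hg => by
          have hsum := hg.trans hy.2
          exact ⟨fun h => (hyM.of_isCoprime_of_dvd_right hg).symm.dvd_of_dvd_mul_right
            ((dvd_add_right h).1 hsum), fun h => (dvd_add_left (h.mul_right _)).1 hsum⟩
        have hgk : Int.gcd A' M = Int.gcd k M := by
          apply Nat.dvd_antisymm
          · refine Int.dvd_gcd ((hgcd _ (Int.gcd_dvd_right _ _)).1 (Int.gcd_dvd_left _ _))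
              (Int.gcd_dvd_right _ _)
          · refine Int.dvd_gcd ((hgcd _ (Int.gcd_dvd_right _ _)).2 (Int.gcd_dvd_left _ _))
              (Int.gcd_dvd_right _ _)
        rw [if_pos (by rw [hgk]; exact Int.gcd_dvd_left _ _), hgk]
        gcongr
        exact card_linear_congruence_le hMpos A' k _ fun y hy => (searchSet_coprime hv hy).1
    · refine le_of_eq_of_le (Finset.sum_eq_zero fun y _ => ?_) zero_le
      rw [ENNReal.tsum_eq_zero]
      intro k
      rw [if_neg]
      rintro ⟨_, hd⟩
      apply hA
      have h1 : ((b ^ v : ℕ) : ℤ) ∣ ((b ^ m : ℕ) : ℤ) := by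
        exact_mod_cast pow_dvd_pow b hv.le
      have h2 : ((b ^ v : ℕ) : ℤ) ∣ k * ((b ^ v * y : ℕ) : ℤ) := by
        push_cast
        exact Dvd.dvd.mul_left (dvd_mul_right _ _) _
      exact (dvd_add_left h2).1 (h1.trans hd)
  · rw [searchSet, if_neg hv, Finset.sum_singleton]
    refine ENNReal.tsum_le_tsum fun k => ?_
    by_cases hk : k = 0
    · simp [hk]
    · simp only [ne_eq, hk, not_false_eq_true, true_and, if_false]
      split_ifs <;> simp

/-! ### The averaging argument for one component and the induction on the dimension. -/

/-- The increase of the squared error when the component `b ^ w d * y` is appended to the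
generating vector of length `d`. -/
def errorIncrement (α : ℝ) (γ : Finset ℕ → ℝ) (b m : ℕ) (w : ℕ → ℕ) (z : ℕ → ℕ) (d y : ℕ) :
    ℝ≥0∞ :=
  ∑' h : Fin d → ℤ, ∑' k : ℤ,
    if k ≠ 0 ∧ ((b ^ m : ℕ) : ℤ) ∣ ∑ j, h j * genVector b w z d j + k * ((b ^ w d * y : ℕ) : ℤ)
    then freqWeight α γ (Fin.snoc h k : Fin (d + 1) → ℤ) else 0

lemma freqWeight_snoc_zero (α : ℝ) (γ : Finset ℕ → ℝ) {d : ℕ} (h : Fin d → ℤ) :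
    freqWeight α γ (Fin.snoc h 0 : Fin (d + 1) → ℤ) = freqWeight α γ h := by
  rw [freqWeight, freqSupport_snoc, prod_decay_snoc, if_pos rfl, decay, if_pos rfl, mul_one,
    freqWeight]

lemma freqWeight_snoc_rpow (α : ℝ) (γ : Finset ℕ → ℝ) {d : ℕ} (h : Fin d → ℤ) {k : ℤ}
    (hk : k ≠ 0) {p : ℝ} (hp : 0 ≤ p) :
    freqWeight α γ (Fin.snoc h k : Fin (d + 1) → ℤ) ^ p =
      ENNReal.ofReal (γ (insert d (freqSupport h))) ^ p *
        (∏ j, decay (α * p) (h j)) * decay (α * p) k := by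
  rw [freqWeight, freqSupport_snoc, prod_decay_snoc, if_neg hk, ENNReal.mul_rpow_of_nonneg _ _ hp,
    ENNReal.mul_rpow_of_nonneg _ _ hp, ← ENNReal.prod_rpow_of_nonneg hp, ← mul_assoc]
  simp only [decay_rpow _ _ _ hp]

lemma sum_snoc_mul_genVector (b : ℕ) (w z : ℕ → ℕ) {d : ℕ} (h : Fin d → ℤ) (k : ℤ) :
    ∑ j, (Fin.snoc h k : Fin (d + 1) → ℤ) j * genVector b w z (d + 1) j =
      ∑ j, h j * genVector b w z d j + k * ((b ^ w d * z d : ℕ) : ℤ) := by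
  rw [Fin.sum_univ_castSucc]
  simp [genVector]

lemma snoc_eq_zero_iff {d : ℕ} (h : Fin d → ℤ) (k : ℤ) :
    (Fin.snoc h k : Fin (d + 1) → ℤ) = 0 ↔ h = 0 ∧ k = 0 := by
  simp [funext_iff, Fin.forall_iff_castSucc, and_comm]

lemma latticeError_succ_sq {α : ℝ} (hα : 1 < α) {γ : Finset ℕ → ℝ} (hγ : ∀ u, 0 < γ u) {b : ℕ}
    (hb : b.Prime) (m : ℕ) (w z : ℕ → ℕ) (d : ℕ) :
    latticeError α γ (b ^ m) (genVector b w z (d + 1)) ^ 2 =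
      latticeError α γ (b ^ m) (genVector b w z d) ^ 2 + errorIncrement α γ b m w z d (z d) := by
  classical
  rw [latticeError_sq hγ (pow_pos hb.pos m) (tsum_freqWeight_ne_top hα γ _),
    latticeError_sq hγ (pow_pos hb.pos m) (tsum_freqWeight_ne_top hα γ _), tsum_snoc,
    errorIncrement, ← ENNReal.tsum_add]
  refine tsum_congr fun h => ?_
  have : ∀ k : ℤ, (dualLattice (b ^ m) (genVector b w z (d + 1))).indicator (freqWeight α γ)
      (Fin.snoc h k : Fin (d + 1) → ℤ) =
      if k = 0 then (dualLattice (b ^ m) (genVector b w z d)).indicator (freqWeight α γ) h else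
        if k ≠ 0 ∧ ((b ^ m : ℕ) : ℤ) ∣
          ∑ j, h j * genVector b w z d j + k * ((b ^ w d * z d : ℕ) : ℤ)
        then freqWeight α γ (Fin.snoc h k : Fin (d + 1) → ℤ) else 0 := fun k => by
    simp only [Set.indicator_apply, dualLattice, Set.mem_ofPred_eq, sum_snoc_mul_genVector, ne_eq,
      snoc_eq_zero_iff]
    by_cases hk : k = 0
    · subst hk
      simp [freqWeight_snoc_zero]
    · simp [hk]
  simp only [this]
  rw [tsum_ite_eq_zero
    (fun _ => (dualLattice (b ^ m) (genVector b w z d)).indicator (freqWeight α γ) h)]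
  congr 1
  refine tsum_congr fun k => ?_
  by_cases hk : k = 0 <;> simp [hk]

/-- The extended real version of `∑_{v ⊆ [d]} γ_{v ∪ {d}}^p (2 ζ(α p))^{|v|}`. -/
def incrementSum (α : ℝ) (γ : Finset ℕ → ℝ) (p : ℝ) (d : ℕ) : ℝ≥0∞ :=
  ∑ v ∈ (Finset.range d).powerset,
    ENNReal.ofReal (γ (insert d v)) ^ p * kernelSum (α * p) ^ v.card

/-- After subadditivity in h and in k, the sum over y moves inside the sum over h, where only the
congruence in the last coordinate depends on y. -/
lemma sum_errorIncrement_rpow_le (α : ℝ) (γ : Finset ℕ → ℝ) {b : ℕ} (hb : b.Prime) (m : ℕ)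
    (w z : ℕ → ℕ) (d : ℕ) {p : ℝ} (hp : 0 < p) (hp1 : p ≤ 1) (hαp : 1 < α * p) :
    ∑ y ∈ searchSet b m (w d), errorIncrement α γ b m w z d y ^ p ≤
      incrementSum α γ p d * kernelSum (α * p) := by
  set A : (Fin d → ℤ) → ℤ := fun h => ∑ j, h j * genVector b w z d j with hA
  set C : (Fin d → ℤ) → ℝ≥0∞ := fun h => ENNReal.ofReal (γ (insert d (freqSupport h))) ^ p *
    (∏ j, decay (α * p) (h j)) with hC
  have h1 : ∀ y, errorIncrement α γ b m w z d y ^ p ≤ ∑' h, C h * ∑' k : ℤ,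
      if k ≠ 0 ∧ ((b ^ m : ℕ) : ℤ) ∣ A h + k * ((b ^ w d * y : ℕ) : ℤ)
      then decay (α * p) k else 0 := fun y => by
    refine (tsum_rpow_le _ hp hp1).trans (ENNReal.tsum_le_tsum fun h => ?_)
    refine (tsum_rpow_le _ hp hp1).trans ?_
    rw [← ENNReal.tsum_mul_left]
    refine ENNReal.tsum_le_tsum fun k => ?_
    split_ifs with hk
    · rw [freqWeight_snoc_rpow α γ h hk.1 hp.le]
    · simp [hp]
  calc _ ≤ ∑ y ∈ searchSet b m (w d), ∑' h, C h * ∑' k : ℤ,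
      (if k ≠ 0 ∧ ((b ^ m : ℕ) : ℤ) ∣ A h + k * ((b ^ w d * y : ℕ) : ℤ)
      then decay (α * p) k else 0) := Finset.sum_le_sum fun y _ => h1 y
    _ = ∑' h, C h * ∑ y ∈ searchSet b m (w d), ∑' k : ℤ,
      (if k ≠ 0 ∧ ((b ^ m : ℕ) : ℤ) ∣ A h + k * ((b ^ w d * y : ℕ) : ℤ)
      then decay (α * p) k else 0) := by
        rw [← Summable.tsum_finsetSum fun _ _ => ENNReal.summable]
        simp only [Finset.mul_sum]
    _ ≤ ∑' h, C h * kernelSum (α * p) := by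
        gcongr with h
        exact sum_searchSet_le hb m (w d) hαp (A h)
    _ = _ := by
        rw [ENNReal.tsum_mul_right, incrementSum, ← tsum_freqSupport (α * p) d
          (fun v => ENNReal.ofReal (γ (insert d v)) ^ p)]

/-- The extended real version of `weightSum`, with `p = 1 / τ`. -/
def weightSumENN (α : ℝ) (γ : Finset ℕ → ℝ) (b : ℕ) (w : ℕ → ℕ) (p : ℝ) (d : ℕ) : ℝ≥0∞ :=
  ∑ u ∈ (Finset.range d).powerset, if u.Nonempty then
    ENNReal.ofReal (γ u) ^ p * kernelSum (α * p) ^ u.card * (b : ℝ≥0∞) ^ u.sup w else 0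

/-- The new sets are those containing d, and on them the maximal exponent is `w d` because w is
monotone. -/
lemma weightSumENN_succ (α : ℝ) (γ : Finset ℕ → ℝ) (b : ℕ) {w : ℕ → ℕ} (hw : Monotone w) (p : ℝ)
    (d : ℕ) :
    weightSumENN α γ b w p (d + 1) = weightSumENN α γ b w p d +
      incrementSum α γ p d * kernelSum (α * p) * (b : ℝ≥0∞) ^ w d := by
  rw [weightSumENN, Finset.range_add_one, Finset.sum_powerset_insert (by simp), ← weightSumENN,
    incrementSum, Finset.sum_mul, Finset.sum_mul]
  congr 1
  refine Finset.sum_congr rfl fun v hv => ?_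
  have hv := Finset.mem_powerset.1 hv
  have hdv : d ∉ v := fun hd => by simpa using hv hd
  have hsup : (insert d v).sup w = w d := by
    rw [Finset.sup_insert]
    exact sup_eq_left.2 (Finset.sup_le fun j hj => hw (Finset.mem_range.1 (hv hj)).le)
  rw [if_pos (Finset.insert_nonempty _ _), hsup, Finset.card_insert_of_notMem hdv, pow_succ]
  ring

lemma add_rpow_mul_card_le {ι : Type*} (Z : Finset ι) (E t : ℝ≥0∞) (θ : ι → ℝ≥0∞) {p : ℝ}
    (hp : 0 < p) (hp1 : p ≤ 1) (ht : ∀ y ∈ Z, E + t ≤ E + θ y) :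
    Z.card * (E + t) ^ p ≤ Z.card * E ^ p + ∑ y ∈ Z, θ y ^ p := by
  rw [← nsmul_eq_mul, ← nsmul_eq_mul, ← Finset.sum_const, ← Finset.sum_const,
    ← Finset.sum_add_distrib]
  exact Finset.sum_le_sum fun y hy => (ENNReal.rpow_le_rpow (ht y hy) hp.le).trans
    (ENNReal.rpow_add_le_add_rpow _ _ hp.le hp1)

/-- The first component is prescribed rather than minimized. It is nevertheless optimal: a frequency
dual to b^{w_0} is dual to all its multiples. Hence the induction can start in dimension 0. -/
lemma errorIncrement_zero_le (α : ℝ) (γ : Finset ℕ → ℝ) (b m : ℕ) (w z : ℕ → ℕ) (y : ℕ) :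
    errorIncrement α γ b m w z 0 1 ≤ errorIncrement α γ b m w z 0 y := by
  have hdvd : ∀ k : ℤ, ((b ^ m : ℕ) : ℤ) ∣ k * ((b ^ w 0 * 1 : ℕ) : ℤ) →
      ((b ^ m : ℕ) : ℤ) ∣ k * ((b ^ w 0 * y : ℕ) : ℤ) := fun k hk => by
    have := hk.mul_right (y : ℤ)
    push_cast at this ⊢
    simpa [mul_assoc] using this
  refine ENNReal.tsum_le_tsum fun h => ENNReal.tsum_le_tsum fun k => ?_
  simp only [Finset.univ_eq_empty, Finset.sum_empty, zero_add]
  split_ifs with h1 h2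
  · exact le_rfl
  · exact absurd ⟨h1.1, hdvd k h1.2⟩ h2
  · exact zero_le
  · exact le_rfl

lemma genVector_update (b : ℕ) (w z : ℕ → ℕ) (d y : ℕ) :
    genVector b w (Function.update z d y) d = genVector b w z d := by
  funext j
  simp [genVector, Function.update_of_ne j.2.ne]

lemma IsReducedCBC.add_errorIncrement_le {α : ℝ} (hα : 1 < α) {γ : Finset ℕ → ℝ}
    (hγ : ∀ u, 0 < γ u) {b : ℕ} (hb : b.Prime) {m : ℕ} {w z : ℕ → ℕ} {s : ℕ}
    (hz : IsReducedCBC α γ b m w s z) {d : ℕ} (hd : d < s) {y : ℕ}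
    (hy : y ∈ searchSet b m (w d)) :
    latticeError α γ (b ^ m) (genVector b w z d) ^ 2 + errorIncrement α γ b m w z d (z d) ≤
      latticeError α γ (b ^ m) (genVector b w z d) ^ 2 + errorIncrement α γ b m w z d y := by
  rcases Nat.eq_zero_or_pos d with rfl | hd0
  · rw [hz.1]
    gcongr
    exact errorIncrement_zero_le α γ b m w z y
  · have := (hz.2 d hd0 hd).2 y hy
    rw [latticeError_succ_sq hα hγ hb, latticeError_succ_sq hα hγ hb, genVector_update,
      Function.update_self] at this
    simpa only [errorIncrement, genVector_update] using this

theorem IsReducedCBC.latticeError_rpow_le {α : ℝ} (hα : 1 < α) {γ : Finset ℕ → ℝ}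
    (hγ : ∀ u, 0 < γ u) {b : ℕ} (hb : b.Prime) {m : ℕ} {w z : ℕ → ℕ} (hw : Monotone w) {s : ℕ}
    (hz : IsReducedCBC α γ b m w s z) {p : ℝ} (hp : 0 < p) (hp1 : p ≤ 1) (hαp : 1 < α * p)
    {d : ℕ} (hd : d ≤ s) :
    (latticeError α γ (b ^ m) (genVector b w z d) ^ 2) ^ p * ((b ^ m : ℕ) : ℝ≥0∞) ≤
      2 * weightSumENN α γ b w p d := by
  induction d with
  | zero =>
    rw [latticeError_sq hγ (pow_pos hb.pos m) (tsum_freqWeight_ne_top hα γ _)]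
    have : dualLattice (b ^ m) (genVector b w z 0) = ∅ :=
      Set.eq_empty_of_forall_notMem fun h hh => hh.1 (Subsingleton.elim _ _)
    simp [this, hp]
  | succ d ih =>
    have ih := ih (by omega)
    rw [latticeError_succ_sq hα hγ hb, weightSumENN_succ α γ b hw]
    set E := latticeError α γ (b ^ m) (genVector b w z d) ^ 2
    set t := errorIncrement α γ b m w z d (z d)
    set Z := searchSet b m (w d)
    have hZ : (Z.card : ℝ≥0∞) ≠ 0 := by
      have := pow_le_card_searchSet hb m (w d)
      have h2 : 0 < b ^ m := pow_pos hb.pos m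
      intro h
      have h3 : (searchSet b m (w d)).card = 0 := by exact_mod_cast h
      rw [h3] at this
      omega
    have key := add_rpow_mul_card_le Z E t (fun y => errorIncrement α γ b m w z d y) hp hp1
      fun y hy => hz.add_errorIncrement_le hα hγ hb (by omega) hy
    have hsum := sum_errorIncrement_rpow_le α γ hb m w z d hp hp1 hαp
    have hcard : ((b ^ m : ℕ) : ℝ≥0∞) ≤ 2 * Z.card * (b : ℝ≥0∞) ^ w d := by
      exact_mod_cast pow_le_card_searchSet hb m (w d)
    set T := incrementSum α γ p d * kernelSum (α * p)
    -- Multiplying by the size of the search space turns "minimum at most average" into a comparison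
    -- of sums.
    rw [← ENNReal.mul_le_mul_iff_right hZ (ENNReal.natCast_ne_top _)]
    calc (Z.card : ℝ≥0∞) * ((E + t) ^ p * ((b ^ m : ℕ) : ℝ≥0∞))
        = (Z.card * (E + t) ^ p) * ((b ^ m : ℕ) : ℝ≥0∞) := by ring
      _ ≤ (Z.card * E ^ p + T) * ((b ^ m : ℕ) : ℝ≥0∞) := by
          gcongr
          exact key.trans (by gcongr)
      _ = Z.card * (E ^ p * ((b ^ m : ℕ) : ℝ≥0∞)) + T * ((b ^ m : ℕ) : ℝ≥0∞) := by ring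
      _ ≤ Z.card * (2 * weightSumENN α γ b w p d) + T * (2 * Z.card * (b : ℝ≥0∞) ^ w d) := by
          gcongr
      _ = _ := by ring

lemma weightSumENN_eq {α : ℝ} {γ : Finset ℕ → ℝ} (hγ : ∀ u, 0 < γ u) (b : ℕ) (w : ℕ → ℕ)
    {τ : ℝ} (hτ : 0 < τ) (hτα : τ < α) (s : ℕ) :
    weightSumENN α γ b w (1 / τ) s = ENNReal.ofReal (weightSum α γ b w τ s) := by
  have hx : 1 < α / τ := (one_lt_div hτ).2 hτα
  have hz := zetaReal_pos hx
  rw [weightSumENN, weightSum, ← Finset.sum_filter, ENNReal.ofReal_sum_of_nonneg]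
  · refine Finset.sum_congr rfl fun u _ => ?_
    rw [mul_one_div, kernelSum_eq hx, ENNReal.ofReal_rpow_of_nonneg (hγ u).le (by positivity),
      ← ENNReal.ofReal_pow (by positivity), ← ENNReal.ofReal_natCast,
      ← ENNReal.ofReal_pow (by positivity),
      ← ENNReal.ofReal_mul (Real.rpow_nonneg (hγ u).le _),
      ← ENNReal.ofReal_mul (mul_nonneg (Real.rpow_nonneg (hγ u).le _) (by positivity))]
  · intro u _
    have := Real.rpow_nonneg (hγ u).le (1 / τ)
    positivity

lemma weightSum_nonneg {α : ℝ} {γ : Finset ℕ → ℝ} (hγ : ∀ u, 0 < γ u) (b : ℕ) (w : ℕ → ℕ)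
    {τ : ℝ} (hτ : 0 < τ) (hτα : τ < α) (s : ℕ) : 0 ≤ weightSum α γ b w τ s := by
  have hz := zetaReal_pos ((one_lt_div hτ).2 hτα)
  refine Finset.sum_nonneg fun u _ => ?_
  have := Real.rpow_nonneg (hγ u).le (1 / τ)
  positivity

theorem IsReducedCBC.latticeError_le {α : ℝ} (hα : 1 < α) {γ : Finset ℕ → ℝ}
    (hγ : ∀ u, 0 < γ u) {b : ℕ} (hb : b.Prime) {m : ℕ} {w z : ℕ → ℕ} (hw : Monotone w) {s : ℕ}
    (hz : IsReducedCBC α γ b m w s z) {τ : ℝ} (hτ : 1 ≤ τ) (hτα : τ < α) :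
    latticeError α γ (b ^ m) (genVector b w z s) ≤
      ENNReal.ofReal ((2 * weightSum α γ b w τ s) ^ (τ / 2) * ((b ^ m : ℕ) : ℝ) ^ (-τ / 2)) := by
  have hτ0 : 0 < τ := by linarith
  have hS := weightSum_nonneg hγ b w hτ0 hτα s
  have hN : (0 : ℝ) < ((b ^ m : ℕ) : ℝ) := by exact_mod_cast pow_pos hb.pos m
  have key := hz.latticeError_rpow_le hα hγ hb hw (p := 1 / τ) (by positivity)
    ((div_le_one hτ0).2 hτ) (by rw [mul_one_div]; exact (one_lt_div hτ0).2 hτα) le_rfl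
  rw [weightSumENN_eq hγ b w hτ0 hτα] at key
  set L := latticeError α γ (b ^ m) (genVector b w z s)
  set S := weightSum α γ b w τ s
  set N : ℝ := ((b ^ m : ℕ) : ℝ) with hNdef
  have h2 : (2 : ℝ≥0∞) * ENNReal.ofReal S = ENNReal.ofReal (2 * S) := by
    rw [ENNReal.ofReal_mul (by norm_num)]; simp
  have h3 : ((b ^ m : ℕ) : ℝ≥0∞) = ENNReal.ofReal N := (ENNReal.ofReal_natCast _).symm
  rw [h2, h3, ← ENNReal.le_div_iff_mul_le (Or.inl (by simpa using hN))
    (Or.inl ENNReal.ofReal_ne_top), ← ENNReal.ofReal_div_of_pos hN] at key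
  have h4 : L = ((L ^ 2) ^ (1 / τ)) ^ (τ / 2) := by
    rw [← ENNReal.rpow_natCast, ← ENNReal.rpow_mul, ← ENNReal.rpow_mul]
    have : ((2 : ℕ) : ℝ) * (1 / τ * (τ / 2)) = 1 := by push_cast; field_simp
    rw [this, ENNReal.rpow_one]
  rw [h4]
  refine (ENNReal.rpow_le_rpow key (by positivity)).trans (le_of_eq ?_)
  rw [ENNReal.ofReal_rpow_of_nonneg (by positivity) (by positivity),
    Real.div_rpow (by positivity) hN.le, neg_div, Real.rpow_neg hN.le]
  rfl

/-! ### Outputs of the algorithm and the information complexity. -/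

lemma genVector_congr (b : ℕ) (w : ℕ → ℕ) {z z' : ℕ → ℕ} {d : ℕ} (h : ∀ j < d, z j = z' j) :
    genVector b w z d = genVector b w z' d := by
  funext j
  simp [genVector, h j j.2]

theorem exists_isReducedCBC (α : ℝ) (γ : Finset ℕ → ℝ) {b : ℕ} (hb : b.Prime) (m : ℕ)
    (w : ℕ → ℕ) (s : ℕ) : ∃ z, IsReducedCBC α γ b m w s z := by
  induction s with
  | zero => exact ⟨fun _ => 1, rfl, fun d _ hd => absurd hd (by omega)⟩
  | succ s ih =>
    obtain ⟨z, hz0, hz⟩ := ih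
    rcases Nat.eq_zero_or_pos s with rfl | hs
    · exact ⟨z, hz0, fun d h1 hd => by omega⟩
    have hne : (searchSet b m (w s)).Nonempty := by
      rw [← Finset.card_pos]
      have h1 := pow_le_card_searchSet hb m (w s)
      have h2 : 0 < b ^ m := pow_pos hb.pos m
      by_contra h
      rw [Nat.eq_zero_of_not_pos h] at h1
      omega
    obtain ⟨y, hy, hmin⟩ := Finset.exists_min_image _ (fun y =>
      latticeError α γ (b ^ m) (genVector b w (Function.update z s y) (s + 1)) ^ 2) hne
    refine ⟨Function.update z s y, by rw [Function.update_of_ne (by omega), hz0], ?_⟩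
    intro d hd hds
    rcases Nat.lt_succ_iff_lt_or_eq.1 hds with hlt | rfl
    · rw [Function.update_of_ne hlt.ne]
      refine ⟨(hz d hd hlt).1, fun y' hy' => ?_⟩
      -- The earlier minimality conditions read only entries below s, so changing entry s does not
      -- affect them.
      rw [genVector_congr b w (z' := z) fun j hj => Function.update_of_ne (by omega) _ _,
        Function.update_comm hlt.ne',
        genVector_congr b w (z := Function.update (Function.update z d y') s y)
          (z' := Function.update z d y')
          fun j hj => Function.update_of_ne (by omega) _ _]
      exact (hz d hd hlt).2 y' hy'
    · rw [Function.update_self]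
      refine ⟨hy, fun y' hy' => ?_⟩
      rw [Function.update_idem]
      exact hmin y' hy'

lemma minimalError_le_latticeError (α : ℝ) (γ : Finset ℕ → ℝ) (N : ℕ) {s : ℕ} (z : Fin s → ℤ) :
    minimalError α γ N s ≤ latticeError α γ N z :=
  iInf_le (fun x : Fin N → Set.Icc (0 : Fin s → ℝ) 1 =>
      worstCaseError α γ fun n => (x n : Fin s → ℝ)) fun n =>
    ⟨latticePoints N z n, fun _ => Int.fract_nonneg _, fun _ => (Int.fract_lt_one _).le⟩

lemma exists_pow_ge {b : ℕ} (hb : 2 ≤ b) (X : ℝ) :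
    ∃ m : ℕ, 1 ≤ m ∧ X ≤ ((b ^ m : ℕ) : ℝ) ∧ ((b ^ m : ℕ) : ℝ) ≤ b * max 1 X := by
  classical
  have hb1 : (1 : ℝ) < b := by exact_mod_cast hb
  have hex : ∃ m : ℕ, 1 ≤ m ∧ X ≤ ((b ^ m : ℕ) : ℝ) := by
    obtain ⟨n, hn⟩ := pow_unbounded_of_one_lt X hb1
    refine ⟨n + 1, by omega, ?_⟩
    push_cast
    exact hn.le.trans (pow_le_pow_right₀ hb1.le (by omega))
  obtain ⟨h1, h2⟩ := Nat.find_spec hex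
  have hmin := fun k (hk : k < Nat.find hex) => Nat.find_min hex hk
  set m := Nat.find hex
  refine ⟨m, h1, h2, ?_⟩
  obtain ⟨n, hn⟩ : ∃ n, m = n + 1 := ⟨m - 1, by omega⟩
  rw [hn, pow_succ, mul_comm, Nat.cast_mul]
  gcongr
  rcases Nat.eq_zero_or_pos n with rfl | hpos
  · simp
  · have := hmin n (by omega)
    push Not at this
    exact (this hpos).le.trans (le_max_right _ _)

theorem infoComplexity_le {α : ℝ} (hα : 1 < α) {γ : Finset ℕ → ℝ} (hγ : ∀ u, 0 < γ u)
    (hγ_empty : γ ∅ = 1) {b : ℕ} (hb : b.Prime) {w : ℕ → ℕ} (hw : Monotone w) {τ : ℝ}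
    (hτ : 1 ≤ τ) (hτα : τ < α) {ε : ℝ} (hε : 0 < ε) (s : ℕ) :
    ∃ N : ℕ, 1 ≤ N ∧ infoComplexity α γ ε s ≤ (N : ℕ∞) ∧
      (N : ℝ) ≤ b * max 1 (2 * weightSum α γ b w τ s * ε ^ (-(2 / τ))) := by
  have hτ0 : 0 < τ := by linarith
  have hS := weightSum_nonneg hγ b w hτ0 hτα s
  obtain ⟨m, _, hm, hm'⟩ := exists_pow_ge hb.two_le (2 * weightSum α γ b w τ s * ε ^ (-(2 / τ)))
  refine ⟨b ^ m, pow_pos hb.pos m, ?_, hm'⟩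
  obtain ⟨z, hz⟩ := exists_isReducedCBC α γ hb m w s
  refine iInf₂_le (b ^ m) ⟨pow_pos hb.pos m, ?_⟩
  refine (minimalError_le_latticeError α γ (b ^ m) (genVector b w z s)).trans
    ((hz.latticeError_le hα hγ hb hw hτ hτα).trans ?_)
  have hN : (0 : ℝ) < ((b ^ m : ℕ) : ℝ) := by exact_mod_cast pow_pos hb.pos m
  set S := weightSum α γ b w τ s
  set N : ℝ := ((b ^ m : ℕ) : ℝ)
  have hle : (2 * S) ^ (τ / 2) * N ^ (-τ / 2) ≤ ε := by
    rw [neg_div, Real.rpow_neg hN.le, ← div_eq_mul_inv, ← Real.div_rpow (by positivity) hN.le]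
    -- This is the choice of m: N ≥ 2Sε^{-2/τ}. Raising it to the power τ/2 gives error at most ε,
    -- which suffices because the initial error is at least 1.
    have h1 : 2 * S / N ≤ ε ^ (2 / τ) := by
      rw [Real.rpow_neg hε.le, ← div_eq_mul_inv, div_le_iff₀ (by positivity)] at hm
      rw [div_le_iff₀ hN]
      linarith
    calc (2 * S / N) ^ (τ / 2) ≤ (ε ^ (2 / τ)) ^ (τ / 2) :=
          Real.rpow_le_rpow (by positivity) h1 (by positivity)
      _ = ε := by
          rw [← Real.rpow_mul hε.le]
          have : 2 / τ * (τ / 2) = 1 := by field_simp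
          rw [this, Real.rpow_one]
  calc ENNReal.ofReal ((2 * S) ^ (τ / 2) * N ^ (-τ / 2)) ≤ ENNReal.ofReal ε * 1 := by
        rw [mul_one]; exact ENNReal.ofReal_le_ofReal hle
    _ ≤ _ := by gcongr; exact one_le_initialError hγ hγ_empty s

/-! ### Polynomial tractability. -/

lemma weightSum_le_supConst {α : ℝ} {γ : Finset ℕ → ℝ} {b : ℕ} {w : ℕ → ℕ} {δ q : ℝ}
    (h : supConst α γ b w δ q < ⊤) {s : ℕ} (hs : 1 ≤ s) :
    weightSum α γ b w (α - 2 * δ) s ≤ (s : ℝ) ^ q * (supConst α γ b w δ q).toReal := by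
  have h1 : ENNReal.ofReal (1 / (s : ℝ) ^ q * weightSum α γ b w (α - 2 * δ) s) ≤
      supConst α γ b w δ q :=
    le_iSup₂ (f := fun (s : ℕ) (_ : 1 ≤ s) =>
      ENNReal.ofReal (1 / (s : ℝ) ^ q * weightSum α γ b w (α - 2 * δ) s)) s hs
  rw [ENNReal.ofReal_le_iff_le_toReal h.ne] at h1
  have hs0 : (0 : ℝ) < (s : ℝ) ^ q := Real.rpow_pos_of_pos (by exact_mod_cast hs) _
  rwa [one_div, inv_mul_le_iff₀ hs0] at h1

lemma latticeError_le_supConst {α : ℝ} (hα : 1 < α) {γ : Finset ℕ → ℝ} (hγ : ∀ u, 0 < γ u)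
    {b : ℕ} (hb : b.Prime) {w : ℕ → ℕ} (hw : Monotone w) {δ : ℝ}
    (hδ : δ ∈ Set.Ioc (0 : ℝ) ((α - 1) / 2)) {q : ℝ} (h : supConst α γ b w δ q < ⊤) {m s : ℕ}
    (hs : 1 ≤ s) {z : Fin s → ℤ} (hz : IsReducedCBCVector α γ b m w s z) :
    latticeError α γ (b ^ m) z ≤
      ENNReal.ofReal ((2 * (s : ℝ) ^ q * (supConst α γ b w δ q).toReal) ^ (α / 2 - δ) *
        ((b ^ m : ℕ) : ℝ) ^ (-α / 2 + δ)) := by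
  obtain ⟨hδ0, hδ1⟩ := hδ
  have hS := weightSum_nonneg (α := α) hγ b w (τ := α - 2 * δ) (by linarith) (by linarith) s
  obtain ⟨z, hz, rfl⟩ := hz
  have := hz.latticeError_le hα hγ hb hw (τ := α - 2 * δ) (by linarith) (by linarith)
  refine this.trans (ENNReal.ofReal_le_ofReal ?_)
  rw [show (α - 2 * δ) / 2 = α / 2 - δ by ring, show -(α - 2 * δ) / 2 = -α / 2 + δ by ring]
  have h1 := weightSum_le_supConst h hs
  refine mul_le_mul_of_nonneg_right (Real.rpow_le_rpow (by positivity) ?_ (by linarith))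
    (by positivity)
  rw [mul_assoc]
  linarith

theorem hasExponents_of_supConst {α : ℝ} (hα : 1 < α) {γ : Finset ℕ → ℝ} (hγ : ∀ u, 0 < γ u)
    (hγ_empty : γ ∅ = 1) {b : ℕ} (hb : b.Prime) {w : ℕ → ℕ} (hw : Monotone w) {δ : ℝ}
    (hδ : δ ∈ Set.Ioc (0 : ℝ) ((α - 1) / 2)) {q : ℝ} (hq : 0 ≤ q)
    (h : supConst α γ b w δ q < ⊤) : HasExponents α γ (2 / (α - 2 * δ)) q := by
  obtain ⟨hδ0, hδ1⟩ := hδ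
  set C := (supConst α γ b w δ q).toReal with hC
  have hC0 : 0 ≤ C := ENNReal.toReal_nonneg
  -- The factor b is the overshoot of the power of b; the summand 1 absorbs the maximum with 1,
  -- since s^q ε^{-p} ≥ 1.
  refine ⟨b * (1 + 2 * C), by positivity, fun s hs ε hε => ?_⟩
  obtain ⟨N, _, hN, hN'⟩ := infoComplexity_le hα hγ hγ_empty hb hw (τ := α - 2 * δ)
    (by linarith) (by linarith) hε.1 s
  have hcast : (infoComplexity α γ ε s : ℝ≥0∞) ≤ ((N : ℕ∞) : ℝ≥0∞) := ENat.toENNReal_le.2 hN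
  refine hcast.trans ?_
  rw [ENat.toENNReal_coe, ← ENNReal.ofReal_natCast]
  refine ENNReal.ofReal_le_ofReal (hN'.trans ?_)
  have hS := weightSum_le_supConst h hs
  have hsq : 1 ≤ (s : ℝ) ^ q := Real.one_le_rpow (by exact_mod_cast hs) hq
  have hεp : 1 ≤ ε ^ (-(2 / (α - 2 * δ))) :=
    Real.one_le_rpow_of_pos_of_le_one_of_nonpos hε.1 hε.2.le
      (neg_nonpos.2 (div_nonneg zero_le_two (by linarith)))
  set P := (s : ℝ) ^ q
  set Q := ε ^ (-(2 / (α - 2 * δ)))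
  have hPQ : 1 ≤ P * Q := one_le_mul_of_one_le_of_one_le hsq hεp
  rw [show (b : ℝ) * (1 + 2 * C) * P * Q = b * ((1 + 2 * C) * (P * Q)) by ring]
  gcongr
  refine max_le ?_ ?_
  · nlinarith
  · calc 2 * weightSum α γ b w (α - 2 * δ) s * Q ≤ 2 * (P * C) * Q := by gcongr
      _ ≤ (1 + 2 * C) * (P * Q) := by nlinarith

/-! ### Weak tractability. -/

lemma log_le_mul_sub_log {η x : ℝ} (hη : 0 < η) (hx : 0 < x) :
    Real.log x ≤ η * x - Real.log η := by
  have := Real.log_le_sub_one_of_pos (mul_pos hη hx)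
  rw [Real.log_mul hη.ne' hx.ne'] at this
  linarith

lemma exists_le_mul_add_of_tendsto_div {u : ℕ → ℝ}
    (hu : Tendsto (fun s : ℕ => u s / (s : ℝ)) atTop (𝓝 0)) {η : ℝ} (hη : 0 < η) :
    ∃ K : ℝ, 0 ≤ K ∧ ∀ s : ℕ, 1 ≤ s → u s ≤ η * s + K := by
  obtain ⟨s₀, hs₀⟩ := eventually_atTop.1 (hu.eventually (gt_mem_nhds hη))
  -- The constant only has to dominate the finitely many terms before the asymptotic bound sets in.
  refine ⟨∑ s ∈ Finset.range s₀, |u s|, Finset.sum_nonneg fun _ _ => abs_nonneg _,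
    fun s hs => ?_⟩
  have hs' : (0 : ℝ) < s := by exact_mod_cast hs
  rcases lt_or_ge s s₀ with hlt | hge
  · have h1 := Finset.single_le_sum (f := fun s => |u s|) (fun _ _ => abs_nonneg _)
      (Finset.mem_range.2 hlt)
    have h2 := le_abs_self (u s)
    have h3 : 0 < η * s := by positivity
    linarith
  · have h1 := hs₀ s hge
    rw [div_lt_iff₀ hs'] at h1
    have h2 : 0 ≤ ∑ s ∈ Finset.range s₀, |u s| := Finset.sum_nonneg fun _ _ => abs_nonneg _
    linarith

/-- The case τ = 1 has log N at most a constant plus log S + 2 log ε⁻¹; the last term is made small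
against ε⁻¹ by log x ≤ ηx - log η. The condition η ≤ 1 keeps the bound nonnegative when the maximum
with 1 equals 1. -/
lemma log_infoComplexity_le {α : ℝ} (hα : 1 < α) {γ : Finset ℕ → ℝ} (hγ : ∀ u, 0 < γ u)
    (hγ_empty : γ ∅ = 1) {b : ℕ} (hb : b.Prime) {w : ℕ → ℕ} (hw : Monotone w)
    {η K ε : ℝ} (hη : 0 < η) (hη1 : η ≤ 1) (hK : 0 ≤ K) (hε : ε ∈ Set.Ioo (0 : ℝ) 1) {s : ℕ}
    (hs : Real.log (weightSum α γ b w 1 s) ≤ η * s + K) :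
    Real.log ((infoComplexity α γ ε s).toNat : ℝ) ≤
      (Real.log b + Real.log 2 + K - 2 * Real.log η) + 2 * η * (s + ε⁻¹) := by
  obtain ⟨N, hN1, hN, hN'⟩ := infoComplexity_le hα hγ hγ_empty hb hw le_rfl hα hε.1 s
  have hb1 : (1 : ℝ) ≤ b := by exact_mod_cast hb.one_lt.le
  have hlogb : 0 ≤ Real.log b := Real.log_nonneg hb1
  have hlog2 : 0 ≤ Real.log 2 := Real.log_nonneg (by norm_num)
  have hlogη : Real.log η ≤ 0 := Real.log_nonpos hη.le hη1
  have hs0 : (0 : ℝ) ≤ η * s := by positivity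
  have hεi : 0 < ε⁻¹ := inv_pos.2 hε.1
  have hεη : 0 < η * ε⁻¹ := by positivity
  have hN1' : (1 : ℝ) ≤ N := by exact_mod_cast hN1
  have h1 : Real.log ((infoComplexity α γ ε s).toNat : ℝ) ≤ Real.log N := by
    -- The value 0 is harmless because `Real.log 0 = 0`, so positivity of the complexity need not be
    -- shown.
    rcases Nat.eq_zero_or_pos (infoComplexity α γ ε s).toNat with h0 | hpos
    · rw [h0]; simpa using Real.log_nonneg hN1'
    · refine Real.log_le_log (by exact_mod_cast hpos) ?_
      have := ENat.toNat_le_toNat hN (ENat.natCast_ne_top N)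
      rw [ENat.toNat_natCast] at this
      exact_mod_cast this
  refine h1.trans ((Real.log_le_log (by linarith) hN').trans ?_)
  rw [Real.log_mul (by positivity) (by positivity)]
  have hmax : Real.log (max 1 (2 * weightSum α γ b w 1 s * ε ^ (-(2 / 1) : ℝ))) ≤
      Real.log 2 + K - 2 * Real.log η + 2 * η * (s + ε⁻¹) := by
    rcases le_or_gt (2 * weightSum α γ b w 1 s * ε ^ (-(2 / 1) : ℝ)) 1 with hle | hgt
    · rw [max_eq_left hle, Real.log_one]
      nlinarith
    · rw [max_eq_right hgt.le]
      have hpow : 0 < ε ^ (-(2 / 1) : ℝ) := Real.rpow_pos_of_pos hε.1 _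
      have hS : weightSum α γ b w 1 s ≠ 0 := fun h0 => by
        rw [h0] at hgt; norm_num at hgt
      rw [Real.log_mul (by positivity) hpow.ne', Real.log_mul (by norm_num) hS,
        Real.log_rpow hε.1]
      have hlogε := log_le_mul_sub_log hη hεi
      rw [Real.log_inv] at hlogε
      nlinarith
  linarith

theorem weaklyTractable_of_tendsto {α : ℝ} (hα : 1 < α) {γ : Finset ℕ → ℝ} (hγ : ∀ u, 0 < γ u)
    (hγ_empty : γ ∅ = 1) {b : ℕ} (hb : b.Prime) {w : ℕ → ℕ} (hw : Monotone w)
    (h : Tendsto (fun s : ℕ => Real.log (weightSum α γ b w 1 s) / (s : ℝ)) atTop (𝓝 0)) :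
    WeaklyTractable α γ := by
  constructor
  · intro s _ ε hε
    obtain ⟨N, _, hN, _⟩ := infoComplexity_le hα hγ hγ_empty hb hw le_rfl hα hε.1 s
    exact ne_top_of_le_ne_top (ENat.natCast_ne_top N) hN
  · rw [Metric.tendsto_nhds]
    intro r hr
    -- With X = s + ε⁻¹ ≥ K'/η the bound K' + 2ηX is at most 3ηX ≤ (3/4)rX < rX.
    set η := min 1 (r / 4) with hη
    have hη0 : 0 < η := lt_min one_pos (by linarith)
    have hηr : η ≤ r / 4 := min_le_right _ _
    obtain ⟨K, hK, hKs⟩ := exists_le_mul_add_of_tendsto_div h hη0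
    set K' := Real.log b + Real.log 2 + K - 2 * Real.log η with hK'
    have hev : ∀ᶠ p : ℕ × ℝ in comap (fun p : ℕ × ℝ => (p.1 : ℝ) + p.2⁻¹) atTop,
        max 1 (K' / η) ≤ (p.1 : ℝ) + p.2⁻¹ :=
      tendsto_comap.eventually (eventually_ge_atTop _)
    rw [eventually_inf_principal]
    filter_upwards [hev] with p hp hp2
    have hX1 : 0 < (p.1 : ℝ) + p.2⁻¹ := lt_of_lt_of_le one_pos ((le_max_left _ _).trans hp)
    have hX2 := (div_le_iff₀ hη0).1 ((le_max_right _ _).trans hp)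
    have hlog := log_infoComplexity_le hα hγ hγ_empty hb hw hη0 (min_le_left _ _) hK hp2.2
      (hKs p.1 hp2.1)
    rw [Real.dist_0_eq_abs, abs_of_nonneg (div_nonneg (Real.log_natCast_nonneg _) hX1.le),
      div_lt_iff₀ hX1]
    nlinarith

end

end ReducedCBC

/-! ### Assembly, with τ = α - 2δ, and τ = 1 for weak tractability. -/

theorem corollary1
    (α : ℝ) (hα : 1 < α)
    (γ : Finset ℕ → ℝ) (hγ : ∀ u, 0 < γ u) (hγ_empty : γ ∅ = 1)
    (b : ℕ) (hb : b.Prime)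
    (w : ℕ → ℕ) (hw : Monotone w) :
    -- the error bound
    (∀ m s : ℕ, 1 ≤ m → 1 ≤ s → ∀ z : Fin s → ℤ, ReducedCBC.IsReducedCBCVector α γ b m w s z →
      ∀ δ ∈ Set.Ioc (0 : ℝ) ((α - 1) / 2),
        ReducedCBC.latticeError α γ (b ^ m) z ≤
          ENNReal.ofReal (ReducedCBC.errorConst α γ b w δ s *
            ((b ^ m : ℕ) : ℝ) ^ (-α / 2 + δ))) ∧
    -- polynomial tractability
    (∀ δ ∈ Set.Ioc (0 : ℝ) ((α - 1) / 2), ∀ q : ℝ, 0 ≤ q →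
      ReducedCBC.supConst α γ b w δ q < ⊤ →
        (∀ m s : ℕ, 1 ≤ m → 1 ≤ s → ∀ z : Fin s → ℤ,
          ReducedCBC.IsReducedCBCVector α γ b m w s z →
            ReducedCBC.latticeError α γ (b ^ m) z ≤
              ENNReal.ofReal
                ((2 * (s : ℝ) ^ q * (ReducedCBC.supConst α γ b w δ q).toReal) ^ (α / 2 - δ) *
                  ((b ^ m : ℕ) : ℝ) ^ (-α / 2 + δ))) ∧
        ReducedCBC.PolynomiallyTractable α γ ∧
        ReducedCBC.HasExponents α γ (2 / (α - 2 * δ)) q ∧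
        ReducedCBC.epsExponent α γ ≤ 2 / (α - 2 * δ) ∧
        ReducedCBC.dimExponent α γ ≤ q) ∧
    -- strong polynomial tractability
    (∀ δ ∈ Set.Ioc (0 : ℝ) ((α - 1) / 2),
      ReducedCBC.supConst α γ b w δ 0 < ⊤ →
        (∀ m s : ℕ, 1 ≤ m → 1 ≤ s → ∀ z : Fin s → ℤ,
          ReducedCBC.IsReducedCBCVector α γ b m w s z →
            ReducedCBC.latticeError α γ (b ^ m) z ≤
              ENNReal.ofReal
                ((2 * (ReducedCBC.supConst α γ b w δ 0).toReal) ^ (α / 2 - δ) *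
                  ((b ^ m : ℕ) : ℝ) ^ (-α / 2 + δ))) ∧
        ReducedCBC.StronglyPolynomiallyTractable α γ ∧
        ReducedCBC.strongEpsExponent α γ ≤ 2 / (α - 2 * δ)) ∧
    -- weak tractability
    (Tendsto
        (fun s : ℕ => Real.log (∑ u ∈ (Finset.range s).powerset.filter (fun u => u.Nonempty),
          γ u * (2 * ReducedCBC.zetaReal α) ^ u.card * (b : ℝ) ^ u.sup w) / (s : ℝ))
        atTop (𝓝 0) →
      ReducedCBC.WeaklyTractable α γ) := by

  have hdiv : ∀ δ ∈ Set.Ioc (0 : ℝ) ((α - 1) / 2), 0 ≤ 2 / (α - 2 * δ) := fun δ hδ =>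
    div_nonneg (by norm_num) (by linarith [hδ.2])
  refine ⟨?_, ?_, ?_, ?_⟩
  · rintro m s - - _ ⟨z, hz, rfl⟩ δ ⟨hδ0, hδ1⟩
    have := hz.latticeError_le hα hγ hb hw (τ := α - 2 * δ) (by linarith) (by linarith)
    rwa [show (α - 2 * δ) / 2 = α / 2 - δ by ring,
      show -(α - 2 * δ) / 2 = -α / 2 + δ by ring] at this
  · intro δ hδ q hq hC
    have hexp := ReducedCBC.hasExponents_of_supConst hα hγ hγ_empty hb hw hδ hq hC
    exact ⟨fun m s _ hs z hz => ReducedCBC.latticeError_le_supConst hα hγ hb hw hδ hC hs hz,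
      ⟨_, q, hdiv δ hδ, hq, hexp⟩, hexp,
      csInf_le ⟨0, fun _ hp => hp.1⟩ ⟨hdiv δ hδ, q, hq, hexp⟩,
      csInf_le ⟨0, fun _ hp => hp.1⟩ ⟨hq, _, hdiv δ hδ, hexp⟩⟩
  · intro δ hδ hC
    have hexp := ReducedCBC.hasExponents_of_supConst hα hγ hγ_empty hb hw hδ le_rfl hC
    refine ⟨fun m s _ hs z hz => ?_, ⟨_, hdiv δ hδ, hexp⟩,
      csInf_le ⟨0, fun _ hp => hp.1⟩ ⟨hdiv δ hδ, hexp⟩⟩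
    simpa only [Real.rpow_zero, mul_one] using
      ReducedCBC.latticeError_le_supConst hα hγ hb hw hδ hC hs hz
  · intro h
    refine ReducedCBC.weaklyTractable_of_tendsto hα hγ hγ_empty hb hw (b := b) (w := w) ?_
    simpa only [ReducedCBC.weightSum, div_one, Real.rpow_one] using h
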